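/- Let $\mathcal G$ be a group bundle groupoid with unit space $X=\mathcal G^{(0)}$, that is, a locally compact Hausdorff topological groupoid whose range and source maps $r,s:\mathcal G\to X$ are equal and open. Let $\lambda=(\lambda^x)_{x\in X}$ be a continuous Haar system on $\mathcal G$: each $\lambda^x$ is a Radon measure on $\mathcal G$ with support exactly $\mathcal G^x=r^{-1}(x)$, one has $\gamma\lambda^{s(\gamma)}=\lambda^{r(\gamma)}$ for all $\gamma\in\mathcal G$, and $x\mapsto\int f\,d\lambda^x$ is continuous for every $f\in C_c(\mathcal G)$. The reduced $C^*$-algebra $C^*_r(\mathcal G)$ is the closure of $\{\Lambda(f)=(\Lambda_x(f))_{x\in X} : f\in C_c(\mathcal G)\}$ with respect to the norm $\sup_{x}\|\Lambda_x(f)\|$, where $\Lambda_x(f)$ is the bounded operator on $L^2(\mathcal G^x,\lambda^x)$ given by $$(\Lambda_x(f)\xi)(\gamma)=\int_{\mathcal G^x} f(\gamma^{-1}\gamma_1)\,\xi(\gamma_1)\,d\lambda^x(\gamma_1).$$ A set $E\subset X$ is invariant if $s(\gamma)\in E\Leftrightarrow r(\gamma)\in E$ for all $\gamma\in\mathcal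 G$. For an open or closed invariant set $E\subset X$, let $\mathcal G(E)=r^{-1}(E)\cap s^{-1}(E)$, with the Haar system $(\lambda^x)_{x\in E}$; write $\mathcal G(x)=\mathcal G(\{x\})$. For a closed invariant set $F\subset X$, extension of functions by zero $C_c(\mathcal G(X\setminus F))\to C_c(\mathcal G)$ and restriction of functions $C_c(\mathcal G)\to C_c(\mathcal G(F))$ extend to $*$-homomorphisms $$0\to C^*_r(\mathcal G(X\setminus F))\to C^*_r(\mathcal G)\xrightarrow{\ \pi_F\ } C^*_r(\mathcal G(F))\to 0. \qquad (\ast_F)$$ The following conditions are equivalent. (i) $\mathcal G$ is inner exact: the sequence $(\ast_F)$ is exact for every closed invariant subset $F$ of $X$. (ii) For every $x\in X$ the sequence $0\to C^*_r(\mathcal G(X\setminus\{x\}))\to C^*_r(\mathcal G)\to C^*_r(\mathcal G(x))\to 0$ is exact. (iii) $C^*_r(\mathcal G)$ is a continuous field of $C^*$-algebras over $X$ with fibres $C^*_r(\mathcal G(x))$. That is, with $A=C^*_r(\mathcal G)$ and the restriction homomorphisms $\pi_x=\pi_{\{x\}}:A\to C^*_r(\mathcal G(x))$: every $\pi_x$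 is surjective; $\|a\|=\sup_{x\in X}\|\pi_x(a)\|$ for all $a\in A$; for all $f\in C_0(X)$ and $a\in A$ there is an element $fa\in A$ with $\pi_x(fa)=f(x)\pi_x(a)$ for all $x\in X$; the elements $fa$ ($f\in C_0(X)$, $a\in A$) span a dense subspace of $A$; and for every $a\in A$ the function $x\mapsto\|\pi_x(a)\|$ belongs to $C_0(X)$. -/

import Mathlib

open MeasureTheory Topology
open scoped ENNReal CompactlySupported ZeroAtInfty

universe u v w

/-- A topological groupoid, given by its space of arrows `G`, its space of units `X` and its
structure maps.  The product `mul γ γ'` is meaningful only if `s γ = r γ'`; its values on other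
pairs are unconstrained.  As `r (unit x) = x`, the map `unit` is a homeomorphism of `X` onto the
subspace of units of `G`. -/
structure TopologicalGroupoid (G : Type u) (X : Type v)
    [TopologicalSpace G] [TopologicalSpace X] where
  r : G → X
  s : G → X
  unit : X → G
  inv : G → G
  mul : G → G → G
  r_unit : ∀ x, r (unit x) = x
  s_unit : ∀ x, s (unit x) = x
  r_inv : ∀ γ, r (inv γ) = s γ
  s_inv : ∀ γ, s (inv γ) = r γ
  r_mul : ∀ γ γ', s γ = r γ' → r (mul γ γ') = r γ
  s_mul : ∀ γ γ', s γ = r γ' → s (mul γ γ') = s γ'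
  mul_assoc : ∀ γ γ' γ'', s γ = r γ' → s γ' = r γ'' →
    mul (mul γ γ') γ'' = mul γ (mul γ' γ'')
  unit_mul : ∀ γ, mul (unit (r γ)) γ = γ
  mul_unit : ∀ γ, mul γ (unit (s γ)) = γ
  inv_mul : ∀ γ, mul (inv γ) γ = unit (s γ)
  mul_inv : ∀ γ, mul γ (inv γ) = unit (r γ)
  continuous_r : Continuous r
  continuous_s : Continuous s
  continuous_unit : Continuous unit
  continuous_inv : Continuous inv
  continuousOn_mul : ContinuousOn (fun p : G × G => mul p.1 p.2) {p | s p.1 = r p.2}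

namespace TopologicalGroupoid

section Groupoid

variable {G : Type u} {X : Type v} [TopologicalSpace G] [TopologicalSpace X]

/-- A group bundle groupoid: the range and source maps are equal and open. -/
def IsGroupBundle (𝒢 : TopologicalGroupoid G X) : Prop :=
  𝒢.r = 𝒢.s ∧ IsOpenMap 𝒢.r

/-- A set `E` of units is invariant if `s γ ∈ E ↔ r γ ∈ E` for every arrow `γ`. -/
def IsInvariant (𝒢 : TopologicalGroupoid G X) (E : Set X) : Prop :=
  ∀ γ, 𝒢.s γ ∈ E ↔ 𝒢.r γ ∈ E

/-- The set of arrows of `𝒢(E)`, that is `r⁻¹(E) ∩ s⁻¹(E)`, as a subspace of `G`. -/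
abbrev Arrows (𝒢 : TopologicalGroupoid G X) (E : Set X) : Type u :=
  {γ : G // 𝒢.r γ ∈ E ∧ 𝒢.s γ ∈ E}

open Classical in
/-- The product of `𝒢(E)`: that of `𝒢` on composable pairs (and a dummy value on other pairs). -/
noncomputable def restrictMul (𝒢 : TopologicalGroupoid G X) (E : Set X) (γ γ' : 𝒢.Arrows E) :
    𝒢.Arrows E :=
  if h : 𝒢.s γ.1 = 𝒢.r γ'.1 then
    ⟨𝒢.mul γ.1 γ'.1, by rw [𝒢.r_mul _ _ h, 𝒢.s_mul _ _ h]; exact ⟨γ.2.1, γ'.2.2⟩⟩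
  else γ

theorem restrictMul_val (𝒢 : TopologicalGroupoid G X) (E : Set X) {γ γ' : 𝒢.Arrows E}
    (h : 𝒢.s γ.1 = 𝒢.r γ'.1) : (𝒢.restrictMul E γ γ').1 = 𝒢.mul γ.1 γ'.1 := by
  rw [restrictMul, dif_pos h]

/-- The groupoid `𝒢(E) = r⁻¹(E) ∩ s⁻¹(E)` with space of units `E`. -/
noncomputable def restrict (𝒢 : TopologicalGroupoid G X) (E : Set X) :
    TopologicalGroupoid (𝒢.Arrows E) E where
  r γ := ⟨𝒢.r γ.1, γ.2.1⟩
  s γ := ⟨𝒢.s γ.1, γ.2.2⟩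
  unit x := ⟨𝒢.unit x.1, (𝒢.r_unit x.1).symm ▸ x.2, (𝒢.s_unit x.1).symm ▸ x.2⟩
  inv γ := ⟨𝒢.inv γ.1, (𝒢.r_inv γ.1).symm ▸ γ.2.2, (𝒢.s_inv γ.1).symm ▸ γ.2.1⟩
  mul := 𝒢.restrictMul E
  r_unit x := Subtype.ext (𝒢.r_unit x.1)
  s_unit x := Subtype.ext (𝒢.s_unit x.1)
  r_inv γ := Subtype.ext (𝒢.r_inv γ.1)
  s_inv γ := Subtype.ext (𝒢.s_inv γ.1)
  r_mul γ γ' h := by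
    have h' : 𝒢.s γ.1 = 𝒢.r γ'.1 := congrArg Subtype.val h
    apply Subtype.ext
    simp only [𝒢.restrictMul_val E h', 𝒢.r_mul _ _ h']
  s_mul γ γ' h := by
    have h' : 𝒢.s γ.1 = 𝒢.r γ'.1 := congrArg Subtype.val h
    apply Subtype.ext
    simp only [𝒢.restrictMul_val E h', 𝒢.s_mul _ _ h']
  mul_assoc γ γ' γ'' h₁ h₂ := by
    have h₁' : 𝒢.s γ.1 = 𝒢.r γ'.1 := congrArg Subtype.val h₁
    have h₂' : 𝒢.s γ'.1 = 𝒢.r γ''.1 := congrArg Subtype.val h₂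
    have e₁ := 𝒢.restrictMul_val E h₁'
    have e₂ := 𝒢.restrictMul_val E h₂'
    apply Subtype.ext
    have e₃ : 𝒢.s (𝒢.restrictMul E γ γ').1 = 𝒢.r γ''.1 := by rw [e₁, 𝒢.s_mul _ _ h₁', h₂']
    have e₄ : 𝒢.s γ.1 = 𝒢.r (𝒢.restrictMul E γ' γ'').1 := by rw [e₂, 𝒢.r_mul _ _ h₂', h₁']
    rw [𝒢.restrictMul_val E e₃, 𝒢.restrictMul_val E e₄, e₁, e₂, 𝒢.mul_assoc _ _ _ h₁' h₂']
  unit_mul γ := by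
    apply Subtype.ext
    rw [𝒢.restrictMul_val E (𝒢.s_unit _), 𝒢.unit_mul]
  mul_unit γ := by
    apply Subtype.ext
    rw [𝒢.restrictMul_val E (𝒢.r_unit _).symm, 𝒢.mul_unit]
  inv_mul γ := by
    apply Subtype.ext
    rw [𝒢.restrictMul_val E (𝒢.s_inv _), 𝒢.inv_mul]
  mul_inv γ := by
    apply Subtype.ext
    rw [𝒢.restrictMul_val E (𝒢.r_inv _).symm, 𝒢.mul_inv]
  continuous_r := (𝒢.continuous_r.comp continuous_subtype_val).subtype_mk _
  continuous_s := (𝒢.continuous_s.comp continuous_subtype_val).subtype_mk _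
  continuous_unit := (𝒢.continuous_unit.comp continuous_subtype_val).subtype_mk _
  continuous_inv := (𝒢.continuous_inv.comp continuous_subtype_val).subtype_mk _
  continuousOn_mul := by
    have h : ContinuousOn (fun p : 𝒢.Arrows E × 𝒢.Arrows E => 𝒢.mul p.1.1 p.2.1)
        {p | 𝒢.s p.1.1 = 𝒢.r p.2.1} :=
      𝒢.continuousOn_mul.comp (f := fun p : 𝒢.Arrows E × 𝒢.Arrows E => (p.1.1, p.2.1))
        (by fun_prop) (fun p hp => hp)
    refine (IsInducing.subtypeVal (t := {γ : G | 𝒢.r γ ∈ E ∧ 𝒢.s γ ∈ E})).continuousOn_iff.2 ?_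
    refine (h.mono fun p hp => ?_).congr fun p hp => ?_
    · have hp' : 𝒢.s p.1.1 = 𝒢.r p.2.1 := congrArg Subtype.val hp
      exact hp'
    · have hp' : 𝒢.s p.1.1 = 𝒢.r p.2.1 := congrArg Subtype.val hp
      exact 𝒢.restrictMul_val E hp'

end Groupoid

section Reduced

variable {G : Type u} {X : Type v} [TopologicalSpace G] [TopologicalSpace X]
  [MeasurableSpace G]

/-- A continuous Haar system `(λ^x)_{x ∈ X}`: a family of Radon measures on `G`, with
`supp λ^x = G^x = r⁻¹(x)`, left invariant (`γ λ^{s γ} = λ^{r γ}`), and such that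
`x ↦ ∫ f dλ^x` is continuous for every continuous compactly supported `f : G → ℂ`. -/
structure IsHaarSystem [BorelSpace G] (𝒢 : TopologicalGroupoid G X) (lam : X → Measure G) :
    Prop where
  regular : ∀ x, (lam x).Regular
  support_eq : ∀ x, (lam x).support = 𝒢.r ⁻¹' {x}
  map_mul : ∀ γ, (lam (𝒢.s γ)).map (𝒢.mul γ) = lam (𝒢.r γ)
  continuous_integral : ∀ f : C_c(G, ℂ), Continuous fun x => ∫ γ, f γ ∂(lam x)

/-- The measures `λ^x`, `x ∈ E`, viewed as measures on the subspace `𝒢(E)` of `G`. -/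
noncomputable def restrictMeasure (𝒢 : TopologicalGroupoid G X) (lam : X → Measure G)
    (E : Set X) (x : E) : Measure (𝒢.Arrows E) :=
  (lam x).comap Subtype.val

/-- The C*-algebra `∏_x B(L²(G^x, λ^x))` of bounded families of bounded operators, with the
supremum norm.  As `λ^x` is carried by `G^x`, one has `L²(G, λ^x) = L²(G^x, λ^x)`. -/
abbrev FibreOperators (lam : X → Measure G) : Type (max u v) :=
  lp (fun x => Lp ℂ 2 (lam x) →L[ℂ] Lp ℂ 2 (lam x)) ∞

noncomputable instance (lam : X → Measure G) : NonUnitalCStarAlgebra (FibreOperators lam) :=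
  inferInstance

/-- `T = (T_x)_x` is the regular representation `Λ(f) = (Λ_x(f))_x` of `f`:
`(Λ_x(f) ξ)(γ) = ∫ f(γ⁻¹ γ₁) ξ(γ₁) dλ^x(γ₁)` for all `ξ ∈ L²(G^x, λ^x)`. -/
def IsRegularRep (𝒢 : TopologicalGroupoid G X) (lam : X → Measure G) (f : G → ℂ)
    (T : FibreOperators lam) : Prop :=
  ∀ (x : X) (ξ : Lp ℂ 2 (lam x)),
    (T x ξ : G → ℂ) =ᵐ[lam x] fun γ => ∫ γ₁, f (𝒢.mul (𝒢.inv γ) γ₁) * ξ γ₁ ∂(lam x)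

/-- There is at most one `Λ(f)`. -/
theorem IsRegularRep.unique {𝒢 : TopologicalGroupoid G X} {lam : X → Measure G} {f : G → ℂ}
    {S T : FibreOperators lam} (hS : 𝒢.IsRegularRep lam f S) (hT : 𝒢.IsRegularRep lam f T) :
    S = T := by
  apply lp.ext
  funext x
  ext1 ξ
  exact Lp.ext ((hS x ξ).trans (hT x ξ).symm)

/-- The reduced C*-algebra `C*_r(𝒢)`: the closed *-subalgebra of `∏_x B(L²(G^x, λ^x))` generated
by the operators `Λ(f)`, for `f` continuous with compact support on `G`.  (These operators already
form a *-subalgebra, and its norm is `‖Λ(f)‖ = sup_x ‖Λ_x(f)‖`.) -/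
noncomputable def reducedAlgebra (𝒢 : TopologicalGroupoid G X) (lam : X → Measure G) :
    NonUnitalStarSubalgebra ℂ (FibreOperators lam) :=
  (NonUnitalStarAlgebra.adjoin ℂ
    {T : FibreOperators lam | ∃ f : C_c(G, ℂ), 𝒢.IsRegularRep lam f T}).topologicalClosure

/-- `C*_r(𝒢)` as a type. -/
def ReducedCStar (𝒢 : TopologicalGroupoid G X) (lam : X → Measure G) : Type (max u v) :=
  𝒢.reducedAlgebra lam

noncomputable instance (𝒢 : TopologicalGroupoid G X) (lam : X → Measure G) :
    NonUnitalCStarAlgebra (𝒢.ReducedCStar lam) :=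
  NonUnitalStarSubalgebra.nonUnitalCStarAlgebra (𝒢.reducedAlgebra lam)
    (h_closed := NonUnitalStarSubalgebra.isClosed_topologicalClosure _)

/-- The C*-algebra `C*_r(𝒢(E))`. -/
abbrev ReducedCStarRestrict (𝒢 : TopologicalGroupoid G X) (lam : X → Measure G)
    (E : Set X) : Type (max u v) :=
  (𝒢.restrict E).ReducedCStar (𝒢.restrictMeasure lam E)

/-- `ι : C*_r(𝒢(U)) → C*_r(𝒢)` extends the inclusion `C_c(𝒢(U)) → C_c(𝒢)` (extension of
functions by zero): `ι (Λ(f)) = Λ(f̃)`, where `f̃` is the extension of `f` by zero. -/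
def IsInclusionHom (𝒢 : TopologicalGroupoid G X) (lam : X → Measure G) (U : Set X)
    (ι : 𝒢.ReducedCStarRestrict lam U →⋆ₙₐ[ℂ] 𝒢.ReducedCStar lam) : Prop :=
  ∀ (f : C_c(𝒢.Arrows U, ℂ)) (T : 𝒢.ReducedCStarRestrict lam U),
    (𝒢.restrict U).IsRegularRep (𝒢.restrictMeasure lam U) f T.1 →
      𝒢.IsRegularRep lam (Function.extend Subtype.val f 0) (ι T).1

/-- `π : C*_r(𝒢) → C*_r(𝒢(F))` extends the restriction map `C_c(𝒢) → C_c(𝒢(F))`: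
`π (Λ(f)) = Λ(f|_{𝒢(F)})`. -/
def IsRestrictionHom (𝒢 : TopologicalGroupoid G X) (lam : X → Measure G) (F : Set X)
    (π : 𝒢.ReducedCStar lam →⋆ₙₐ[ℂ] 𝒢.ReducedCStarRestrict lam F) : Prop :=
  ∀ (f : C_c(G, ℂ)) (T : 𝒢.ReducedCStar lam),
    𝒢.IsRegularRep lam f T.1 →
      (𝒢.restrict F).IsRegularRep (𝒢.restrictMeasure lam F) (fun γ => f γ.1) (π T).1

/-- The sequence `0 → C*_r(𝒢(X ∖ F)) → C*_r(𝒢) → C*_r(𝒢(F)) → 0` of canonical maps is exact. -/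
def IsExactSequence (𝒢 : TopologicalGroupoid G X) (lam : X → Measure G) (F : Set X) : Prop :=
  ∃ (ι : 𝒢.ReducedCStarRestrict lam Fᶜ →⋆ₙₐ[ℂ] 𝒢.ReducedCStar lam)
    (π : 𝒢.ReducedCStar lam →⋆ₙₐ[ℂ] 𝒢.ReducedCStarRestrict lam F),
    𝒢.IsInclusionHom lam Fᶜ ι ∧ 𝒢.IsRestrictionHom lam F π ∧
      Function.Injective ι ∧ Function.Exact ι π ∧ Function.Surjective π

/-- Inner exactness: the sequence is exact for every closed invariant set `F` of units. -/
def IsInnerExact (𝒢 : TopologicalGroupoid G X) (lam : X → Measure G) : Prop :=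
  ∀ F : Set X, IsClosed F → 𝒢.IsInvariant F → 𝒢.IsExactSequence lam F

end Reduced

end TopologicalGroupoid

/-- A field `(A, {π_x : A → A_x}_{x ∈ X}, X)` of C*-algebras over `X`.  By `norm_eq`, the element
`fa` in `exists_smul` is unique, so that `C₀(X)` acts on `A` by central multipliers; `nondegenerate`
says that the elements `fa` span a dense subspace of `A`. -/
structure IsCStarField {X : Type u} [TopologicalSpace X] {A : Type v} [NonUnitalCStarAlgebra A]
    {B : X → Type w} [∀ x, NonUnitalCStarAlgebra (B x)] (π : ∀ x, A →⋆ₙₐ[ℂ] B x) : Prop where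
  surjective : ∀ x, Function.Surjective (π x)
  norm_eq : ∀ a, ‖a‖ = ⨆ x, ‖π x a‖
  exists_smul : ∀ (f : C₀(X, ℂ)) (a : A), ∃ b : A, ∀ x, π x b = f x • π x a
  nondegenerate : Dense (Submodule.span ℂ
    {b : A | ∃ (f : C₀(X, ℂ)) (a : A), ∀ x, π x b = f x • π x a} : Set A)

/-- A continuous field of C*-algebras: the functions `x ↦ ‖π_x(a)‖` are in `C₀(X)`. -/
structure IsContinuousCStarField {X : Type u} [TopologicalSpace X] {A : Type v}
    [NonUnitalCStarAlgebra A] {B : X → Type w} [∀ x, NonUnitalCStarAlgebra (B x)]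
    (π : ∀ x, A →⋆ₙₐ[ℂ] B x) : Prop extends IsCStarField π where
  norm_mem : ∀ a : A, ∃ g : C₀(X, ℝ), ∀ x, g x = ‖π x a‖

/-! An element of `C*_r(𝒢)` is a family `a = (a_x)` of operators on the spaces `L²(G^x, λ^x)`, and
`‖π_x(a)‖ = ‖a_x‖` (`norm_restrictHom_singleton`). All three conditions are therefore about the
functions `x ↦ ‖a_x‖`.

Most of the continuous field structure is automatic. As `r = s`, a function `g` in `C₀(X)`
multiplies families fibrewise and sends `Λ(f)` to `Λ((g ∘ r) f)`, so it preserves the algebra. The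
norm functions vanish at infinity, because `Λ(f)` vanishes off `r(supp f)`. They are also lower
semicontinuous: a *-polynomial in the `Λ(f)` maps sections coming from `C_c(𝒢)` to such sections,
and by the Haar system axiom these have continuous norm (`lowerSemicontinuous_norm`). Only upper
semicontinuity can fail.

Exactness at `x` supplies it (`eventually_norm_lt`): `a* a` is a lift of `π_x(a* a)` of norm at most
`‖a_x‖²`, plus an element of `C*_r(𝒢(X ∖ {x}))`; the latter is approximated by families vanishing
near `x`.

Conversely, let the norm functions be in `C₀(X)` and let `a` vanish on a closed set `F`. The set
`{‖a_x‖ ≥ ε/2}` is compact and disjoint from `F`, so a bump function cuts `a` down, with error at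
most `ε/2`, to a family living over a compact subset of `X ∖ F`. Such a family belongs to `C*_r(𝒢(X
∖ F))` (`restrictFamily_diag_mul_mem`), which gives exactness in the middle (`isExactSequence`). The
two ends are always exact. -/

set_option linter.unusedSectionVars false

/-! ### Extension and density of compactly supported functions -/

/-- **Tietze extension** for compactly supported functions on a closed subset of a locally compact
Hausdorff space. -/
theorem exists_compactlySupported_eqOn {Y : Type*} [TopologicalSpace Y] [T2Space Y]
    [LocallyCompactSpace Y] {C K : Set Y} (hC : IsClosed C) (hK : IsCompact K) {f : Y → ℂ}
    (hf : ContinuousOn f C) (hfK : ∀ y ∈ C, y ∉ K → f y = 0) :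
    ∃ g : C_c(Y, ℂ), ∀ y ∈ C, g y = f y := by
  obtain ⟨K', hK', hKK'⟩ := exists_compact_superset hK
  have hCK : IsCompact (C ∩ K') := hK'.inter_left hC
  have : CompactSpace (C ∩ K' : Set Y) := isCompact_iff_compactSpace.1 hCK
  -- A locally compact Hausdorff space need not be normal, but its one-point compactification is;
  -- the compact set `C ∩ K'` is closed there. The cutoff `φ`, equal to `1` on `K` and `0` off `K'`,
  -- then restores compact support.
  have he : IsClosedEmbedding (fun y : (C ∩ K' : Set Y) => ((y : Y) : OnePoint Y)) :=
    (OnePoint.continuous_coe.comp continuous_subtype_val).isClosedEmbedding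
      (OnePoint.coe_injective.comp Subtype.val_injective)
  obtain ⟨g, hg⟩ := ContinuousMap.exists_extension' he
    (⟨fun y => f y.1, continuousOn_iff_continuous_domRestrict.1 (hf.mono Set.inter_subset_left)⟩ :
      C((C ∩ K' : Set Y), ℂ))
  obtain ⟨φ, hφ1, hφ0, hφc, -⟩ := exists_continuous_one_zero_of_isCompact hK
    (isOpen_interior (s := K')).isClosed_compl (Set.disjoint_compl_right_iff_subset.2 hKK')
  have hφ0' : ∀ y, y ∉ K' → φ y = 0 := fun y hy => hφ0 fun h => hy (interior_subset h)
  refine ⟨⟨⟨fun y => (φ y : ℂ) * g (y : OnePoint Y), ?_⟩, ?_⟩, fun y hy => ?_⟩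
  · exact (Complex.continuous_ofReal.comp φ.continuous).mul
      (g.continuous.comp OnePoint.continuous_coe)
  · refine HasCompactSupport.intro hK' fun y hy => ?_
    simp [hφ0' y hy]
  · change (φ y : ℂ) * g (y : OnePoint Y) = f y
    by_cases hyK' : y ∈ K'
    · have h1 : g (y : OnePoint Y) = f y := congrFun hg ⟨y, hy, hyK'⟩
      by_cases hyK : y ∈ K
      · rw [h1, hφ1 hyK]; simp
      · rw [h1, hfK y hy hyK, mul_zero]
    · rw [hφ0' y hyK', hfK y hy fun h => hyK' (interior_subset (hKK' h))]; simp

/-- In a locally compact Hausdorff space, functions in `ℒ^p`, `p < ∞`, with respect to a regular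
measure can be approximated by compactly supported continuous functions. -/
theorem MeasureTheory.MemLp.exists_compactlySupported_eLpNorm_sub_le {α : Type*}
    [TopologicalSpace α] [T2Space α] [LocallyCompactSpace α] [MeasurableSpace α] [BorelSpace α]
    {μ : Measure α} [μ.Regular] {p : ℝ≥0∞} (hp : p ≠ ∞) {f : α → ℂ} (hf : MemLp f p μ)
    {ε : ℝ≥0∞} (hε : ε ≠ 0) : ∃ g : C_c(α, ℂ), eLpNorm (f - ⇑g) p μ ≤ ε := by
  suffices H : ∃ g : α → ℂ, eLpNorm (f - g) p μ ≤ ε ∧ Continuous g ∧ HasCompactSupport g by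
    obtain ⟨g, h, hg, hgc⟩ := H
    exact ⟨⟨⟨g, hg⟩, hgc⟩, h⟩
  refine hf.induction_dense hp _ ?_ (fun f g hf hg => ⟨hf.1.add hg.1, hf.2.add hg.2⟩)
    (fun f hf => ?_) hε
  swap
  · exact (hf.1.memLp_of_hasCompactSupport hf.2 (p := 1)).aestronglyMeasurable
  intro c t ht htμ ε hε
  obtain ⟨η, ηpos, hη⟩ := exists_eLpNorm_indicator_le (μ := μ) hp c hε
  have hη2 : ((η / 2 : NNReal) : ℝ≥0∞) ≠ 0 := by
    have : η / 2 ≠ 0 := (half_pos ηpos).ne'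
    exact_mod_cast this
  obtain ⟨s, st, s_compact, s_closed, μs⟩ := ht.exists_isCompact_isClosed_sdiff_lt htμ.ne hη2
  have hsμ : μ s < ∞ := (measure_mono st).trans_lt htμ
  -- `V` surrounds the compact set `s`, not `t`, so that Urysohn's lemma for compact sets applies.
  -- The error lives on `(V \ s) ∪ (t \ s)`, each piece having measure less than `η / 2`.
  obtain ⟨V, sV, V_open, -, hV⟩ := s_closed.measurableSet.exists_isOpen_sdiff_lt hsμ.ne hη2
  obtain ⟨φ, hφ1, hφ0, hφc, hφ⟩ := exists_continuous_one_zero_of_isCompact s_compact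
    V_open.isClosed_compl (Set.disjoint_compl_right_iff_subset.2 sV)
  refine ⟨fun x => φ x * c, ?_, by fun_prop, ?_⟩
  · have hμ : μ (V \ s ∪ t \ s) ≤ η := by
      refine (measure_union_le _ _).trans ((add_le_add hV.le μs.le).trans (le_of_eq ?_))
      rw [← ENNReal.coe_add, add_halves]
    refine (eLpNorm_mono fun x => ?_).trans (hη _ hμ)
    have hx := hφ x
    simp only [Pi.sub_apply]
    by_cases hxs : x ∈ s
    · simp [hφ1 hxs, st hxs]
    by_cases hxV : x ∈ V
    · rw [Set.indicator_of_mem (Set.mem_union_left (t \ s) (Set.mem_sdiff_of_mem hxV hxs))]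
      have h0 : ‖(φ x : ℂ) * c‖ ≤ ‖c‖ := by
        rw [norm_mul, Complex.norm_real, Real.norm_eq_abs, abs_of_nonneg hx.1]
        exact mul_le_of_le_one_left (norm_nonneg _) hx.2
      by_cases hxt : x ∈ t
      · rw [Set.indicator_of_mem hxt]
        have : (φ x : ℂ) * c - c = ((φ x - 1 : ℝ) : ℂ) * c := by push_cast; ring
        rw [this, norm_mul, Complex.norm_real, Real.norm_eq_abs]
        refine mul_le_of_le_one_left (norm_nonneg _) (abs_le.2 ⟨?_, ?_⟩) <;> linarith [hx.1, hx.2]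
      · rwa [Set.indicator_of_notMem hxt, sub_zero]
    · rw [hφ0 hxV]
      by_cases hxt : x ∈ t
      · rw [Set.indicator_of_mem hxt,
          Set.indicator_of_mem (Set.mem_union_right (V \ s) (Set.mem_sdiff_of_mem hxt hxs))]
        simp
      · simp [Set.indicator_of_notMem hxt]
  · exact (hφc.comp_left (g := ((↑) : ℝ → ℂ)) rfl).mul_right

/-! ### Lifting along *-homomorphisms of C*-algebras -/

section CStar

variable {A : Type*} {B : Type*} [NonUnitalCStarAlgebra A] [NonUnitalCStarAlgebra B]

theorem NonUnitalStarAlgHom.continuous_of_cstar (φ : A →⋆ₙₐ[ℂ] B) : Continuous φ :=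
  AddMonoidHomClass.continuous_of_bound φ 1
    fun a => by simpa using NonUnitalStarAlgHom.norm_apply_le φ a

/-- A self-adjoint element in the range of a *-homomorphism of C*-algebras lifts without increase
of the norm. -/
theorem NonUnitalStarAlgHom.exists_lift_of_isSelfAdjoint (φ : A →⋆ₙₐ[ℂ] B) {a : A}
    (ha : IsSelfAdjoint a) : ∃ a', φ a' = φ a ∧ ‖a'‖ ≤ ‖φ a‖ := by
  set c : ℝ := ‖φ a‖ with hc
  have hc0 : 0 ≤ c := norm_nonneg _
  -- Truncation to `[-c, c]`. It is the identity on the spectrum of `φ a`, so applying it to `a`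
  -- does not change the image but cuts the norm down to `c`.
  let k : ℝ → ℝ := fun t => max (-c) (min t c)
  have hk : Continuous k := by fun_prop
  have hk0 : k 0 = 0 := by simp [k, hc0]
  have hφa : IsSelfAdjoint (φ a) := ha.map φ
  refine ⟨cfcₙ k a, ?_, ?_⟩
  · rw [NonUnitalStarAlgHom.map_cfcₙ φ k a hk.continuousOn hk0 φ.continuous_of_cstar ha hφa]
    conv_rhs => rw [← cfcₙ_id ℝ (φ a) hφa]
    refine cfcₙ_congr fun t ht => ?_
    have : ‖t‖ ≤ c := by
      simpa [cfcₙ_id' ℝ (φ a) hφa] using norm_apply_le_norm_cfcₙ (fun s : ℝ => s) (φ a) ht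
    rw [Real.norm_eq_abs, abs_le] at this
    simp [k, this.1, this.2]
  · refine norm_cfcₙ_le fun t _ => ?_
    rw [Real.norm_eq_abs, abs_le]
    exact ⟨le_max_left _ _, max_le (by linarith) (min_le_right _ _)⟩

/-- Real and imaginary parts are lifted separately, whence the factor `2`. This weak bound is enough
for the open-mapping type argument giving closed range. -/
theorem NonUnitalStarAlgHom.exists_lift_norm_le (φ : A →⋆ₙₐ[ℂ] B) (a : A) :
    ∃ a', φ a' = φ a ∧ ‖a'‖ ≤ 2 * ‖φ a‖ := by
  obtain ⟨b, hb, hb'⟩ := φ.exists_lift_of_isSelfAdjoint (realPart a).2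
  obtain ⟨c, hc, hc'⟩ := φ.exists_lift_of_isSelfAdjoint (imaginaryPart a).2
  refine ⟨b + Complex.I • c, ?_, ?_⟩
  · rw [map_add, map_smul, hb, hc, ← map_smul, ← map_add, realPart_add_I_smul_imaginaryPart]
  · rw [map_realPart] at hb'
    rw [map_imaginaryPart] at hc'
    have h1 := hb'.trans (realPart.norm_le (φ a))
    have h2 := hc'.trans (imaginaryPart.norm_le (φ a))
    refine (norm_add_le _ _).trans ?_
    rw [norm_smul, Complex.norm_I, one_mul]
    linarith

/-- The range of a *-homomorphism of C*-algebras is closed. -/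
theorem NonUnitalStarAlgHom.surjective_of_denseRange (φ : A →⋆ₙₐ[ℂ] B) (h : DenseRange φ) :
    Function.Surjective φ := by
  let f : NormedAddGroupHom A B := AddMonoidHom.mkNormedAddGroupHom (φ : A →+ B) 1
    fun a => by simpa using NonUnitalStarAlgHom.norm_apply_le φ a
  have hf : f.SurjectiveOnWith f.range 2 := by
    rintro b ⟨a, rfl⟩
    exact φ.exists_lift_norm_le a
  intro b
  obtain ⟨a, ha, -⟩ := controlled_closure_of_complete two_pos one_pos hf b (h b)
  exact ⟨a, ha⟩

end CStar

/-! ### The unit space -/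

namespace TopologicalGroupoid

variable {G : Type u} {X : Type v} [TopologicalSpace G] [TopologicalSpace X]

theorem isEmbedding_unit (𝒢 : TopologicalGroupoid G X) : IsEmbedding 𝒢.unit :=
  .of_leftInverse 𝒢.r_unit 𝒢.continuous_r 𝒢.continuous_unit

theorem t2Space_units [T2Space G] (𝒢 : TopologicalGroupoid G X) : T2Space X :=
  𝒢.isEmbedding_unit.t2Space

theorem locallyCompactSpace_units [T2Space G] [LocallyCompactSpace G]
    (𝒢 : TopologicalGroupoid G X) : LocallyCompactSpace X := by
  have : IsClosedEmbedding 𝒢.unit := by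
    refine ⟨𝒢.isEmbedding_unit, ?_⟩
    -- The units are the fixed points of the continuous map `γ ↦ unit (r γ)`, hence form a closed
    -- set.
    have h : Set.range 𝒢.unit = {γ | 𝒢.unit (𝒢.r γ) = γ} := by
      ext γ
      constructor
      · rintro ⟨x, rfl⟩
        simp [𝒢.r_unit]
      · exact fun h => ⟨_, h⟩
    rw [h]
    exact isClosed_eq (𝒢.continuous_unit.comp 𝒢.continuous_r) continuous_id
  exact this.locallyCompactSpace

end TopologicalGroupoid

namespace TopologicalGroupoid

/-! ### Groupoid identities and compactness of products -/

section Algebra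

variable {G : Type u} {X : Type v} [TopologicalSpace G] [TopologicalSpace X]
  (𝒢 : TopologicalGroupoid G X)

theorem inv_mul_cancel_left' {γ γ₁ : G} (h : 𝒢.s γ = 𝒢.r γ₁) :
    𝒢.mul (𝒢.inv γ) (𝒢.mul γ γ₁) = γ₁ := by
  rw [← 𝒢.mul_assoc _ _ _ (𝒢.s_inv γ) h, 𝒢.inv_mul, h, 𝒢.unit_mul]

theorem mul_inv_cancel_left' {γ γ₁ : G} (h : 𝒢.r γ = 𝒢.r γ₁) :
    𝒢.mul γ (𝒢.mul (𝒢.inv γ) γ₁) = γ₁ := by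
  rw [← 𝒢.mul_assoc _ _ _ (𝒢.r_inv γ).symm ((𝒢.s_inv γ).trans h), 𝒢.mul_inv, h, 𝒢.unit_mul]

theorem r_inv_mul {γ γ₁ : G} (h : 𝒢.r γ = 𝒢.r γ₁) : 𝒢.r (𝒢.mul (𝒢.inv γ) γ₁) = 𝒢.s γ := by
  rw [𝒢.r_mul _ _ ((𝒢.s_inv γ).trans h), 𝒢.r_inv]

theorem s_inv_mul {γ γ₁ : G} (h : 𝒢.r γ = 𝒢.r γ₁) : 𝒢.s (𝒢.mul (𝒢.inv γ) γ₁) = 𝒢.s γ₁ :=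
  𝒢.s_mul _ _ ((𝒢.s_inv γ).trans h)

/-- With `p = γ⁻¹ γ₁` and `q = γ₁⁻¹ γ`, the product `q p` is a unit; multiplying by `p⁻¹` on the
right gives `q = p⁻¹`. -/
theorem inv_inv_mul {γ γ₁ : G} (h : 𝒢.r γ = 𝒢.r γ₁) :
    𝒢.inv (𝒢.mul (𝒢.inv γ) γ₁) = 𝒢.mul (𝒢.inv γ₁) γ := by
  set p := 𝒢.mul (𝒢.inv γ) γ₁ with hp
  set q := 𝒢.mul (𝒢.inv γ₁) γ with hq
  have hsq : 𝒢.s q = 𝒢.r p := by rw [𝒢.s_inv_mul h.symm, 𝒢.r_inv_mul h]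
  have hqp : 𝒢.mul q p = 𝒢.unit (𝒢.s γ₁) := by
    rw [hq, 𝒢.mul_assoc _ _ _ ((𝒢.s_inv _).trans h.symm) (𝒢.r_inv_mul h).symm,
      𝒢.mul_inv_cancel_left' h, 𝒢.inv_mul]
  have h1 : 𝒢.mul (𝒢.mul q p) (𝒢.inv p) = q := by
    rw [𝒢.mul_assoc _ _ _ hsq (𝒢.r_inv p).symm, 𝒢.mul_inv, ← hsq, 𝒢.mul_unit]
  have h2 : 𝒢.s γ₁ = 𝒢.r (𝒢.inv p) := by rw [𝒢.r_inv, 𝒢.s_inv_mul h]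
  rw [hqp, h2, 𝒢.unit_mul] at h1
  exact h1

theorem inv_inv' (γ : G) : 𝒢.inv (𝒢.inv γ) = γ := by
  have h1 : 𝒢.mul (𝒢.inv (𝒢.inv γ)) (𝒢.mul (𝒢.inv γ) γ) = γ :=
    𝒢.inv_mul_cancel_left' (𝒢.s_inv γ)
  rw [𝒢.inv_mul] at h1
  have h2 : 𝒢.s (𝒢.inv (𝒢.inv γ)) = 𝒢.s γ := by rw [𝒢.s_inv, 𝒢.r_inv]
  rw [← h2, 𝒢.mul_unit] at h1
  exact h1

theorem continuousOn_inv_mul :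
    ContinuousOn (fun p : G × G => 𝒢.mul (𝒢.inv p.1) p.2) {p | 𝒢.r p.1 = 𝒢.r p.2} := by
  refine 𝒢.continuousOn_mul.comp (f := fun p : G × G => (𝒢.inv p.1, p.2)) ?_ ?_
  · exact ((𝒢.continuous_inv.comp continuous_fst).prodMk continuous_snd).continuousOn
  · intro p hp
    exact (𝒢.s_inv p.1).trans hp

theorem continuousOn_mul_left (γ : G) : ContinuousOn (𝒢.mul γ) {γ₁ | 𝒢.s γ = 𝒢.r γ₁} :=
  𝒢.continuousOn_mul.comp (f := fun γ₁ : G => (γ, γ₁)) (by fun_prop) fun _ h => h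

/-- The product of two subsets of a groupoid. -/
def mulSet (K L : Set G) : Set G :=
  (fun p : G × G => 𝒢.mul p.1 p.2) '' (K ×ˢ L ∩ {p | 𝒢.s p.1 = 𝒢.r p.2})

theorem isCompact_mulSet [T2Space G] {K L : Set G} (hK : IsCompact K) (hL : IsCompact L) :
    IsCompact (𝒢.mulSet K L) := by
  have := 𝒢.t2Space_units
  refine ((hK.prod hL).inter_right ?_).image_of_continuousOn
    (𝒢.continuousOn_mul.mono Set.inter_subset_right)
  exact isClosed_eq (𝒢.continuous_s.comp continuous_fst) (𝒢.continuous_r.comp continuous_snd)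

theorem mem_mulSet {K L : Set G} {γ γ₁ : G} (hγ : γ ∈ K) (hγ₁ : γ₁ ∈ L) (h : 𝒢.s γ = 𝒢.r γ₁) :
    𝒢.mul γ γ₁ ∈ 𝒢.mulSet K L :=
  ⟨(γ, γ₁), ⟨⟨hγ, hγ₁⟩, h⟩, rfl⟩

/-- Writing `γ = γ₁ (γ⁻¹ γ₁)⁻¹` bounds the support of a convolution by a product of compact sets. -/
theorem mem_mulSet_inv {K L : Set G} {γ γ₁ : G} (h : 𝒢.r γ = 𝒢.r γ₁) (hγ₁ : γ₁ ∈ K)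
    (hL : 𝒢.mul (𝒢.inv γ) γ₁ ∈ L) : γ ∈ 𝒢.mulSet K (𝒢.inv '' L) := by
  have h1 := 𝒢.mem_mulSet hγ₁ (Set.mem_image_of_mem 𝒢.inv hL)
    (by rw [𝒢.r_inv, 𝒢.s_inv_mul h])
  rwa [𝒢.inv_inv_mul h, 𝒢.mul_inv_cancel_left' h.symm] at h1

/-- The left translate of a compactly supported function coincides, on the range fibre, with a
compactly supported function. -/
theorem exists_translate [T2Space G] [LocallyCompactSpace G] (f : C_c(G, ℂ)) (γ : G) :
    ∃ g : C_c(G, ℂ), ∀ γ₁, 𝒢.r γ₁ = 𝒢.r γ → g γ₁ = f (𝒢.mul (𝒢.inv γ) γ₁) := by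
  have := 𝒢.t2Space_units
  refine exists_compactlySupported_eqOn (C := {γ₁ | 𝒢.r γ₁ = 𝒢.r γ})
    (isClosed_eq 𝒢.continuous_r continuous_const)
    (𝒢.isCompact_mulSet (isCompact_singleton (x := γ)) f.hasCompactSupport.isCompact)
    (f := fun γ₁ => f (𝒢.mul (𝒢.inv γ) γ₁)) ?_ ?_
  · refine f.continuous.comp_continuousOn ((𝒢.continuousOn_mul_left _).mono ?_)
    intro γ₁ h
    exact (𝒢.s_inv γ).trans (Eq.symm h)
  · intro γ₁ h hγ₁
    by_contra h0
    apply hγ₁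
    have := 𝒢.mem_mulSet (Set.mem_singleton γ) (subset_tsupport f h0)
      (𝒢.r_inv_mul (Eq.symm h)).symm
    rwa [𝒢.mul_inv_cancel_left' (Eq.symm h)] at this

end Algebra

/-! ### Haar integrals and the field of Hilbert spaces `L²(G^x, λ^x)` -/

section Fibre

variable {G : Type u} {X : Type v} [TopologicalSpace G] [TopologicalSpace X]
  [LocallyCompactSpace G] [T2Space G] [MeasurableSpace G] [BorelSpace G]
  {𝒢 : TopologicalGroupoid G X} {lam : X → Measure G}

namespace IsHaarSystem

/-- A regular measure is carried by its support. Hence the unconstrained values of `mul` on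
non-composable pairs never enter an integral. -/
theorem ae_r_eq (hlam : 𝒢.IsHaarSystem lam) (x : X) : ∀ᵐ γ ∂(lam x), 𝒢.r γ = x := by
  have := hlam.regular x
  have h := Measure.support_mem_ae_of_regular (μ := lam x)
  rw [hlam.support_eq x] at h
  exact h

theorem memLp (hlam : 𝒢.IsHaarSystem lam) (ξ : C_c(G, ℂ)) (x : X) (p : ℝ≥0∞) :
    MemLp ξ p (lam x) := by
  have := hlam.regular x
  exact ξ.continuous.memLp_of_hasCompactSupport ξ.hasCompactSupport

theorem integrable (hlam : 𝒢.IsHaarSystem lam) (ξ : C_c(G, ℂ)) (x : X) :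
    Integrable ξ (lam x) :=
  memLp_one_iff_integrable.1 (hlam.memLp ξ x 1)

/-- The section of the field of Hilbert spaces `L²(G^x, λ^x)` given by a compactly supported
continuous function. -/
noncomputable def toL2 (hlam : 𝒢.IsHaarSystem lam) (ξ : C_c(G, ℂ)) (x : X) : Lp ℂ 2 (lam x) :=
  (hlam.memLp ξ x 2).toLp ξ

theorem coeFn_toL2 (hlam : 𝒢.IsHaarSystem lam) (ξ : C_c(G, ℂ)) (x : X) :
    (hlam.toL2 ξ x : G → ℂ) =ᵐ[lam x] ξ :=
  (hlam.memLp ξ x 2).coeFn_toLp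

theorem denseRange_toL2 (hlam : 𝒢.IsHaarSystem lam) (x : X) :
    DenseRange fun ξ : C_c(G, ℂ) => hlam.toL2 ξ x := by
  have := hlam.regular x
  intro ξ
  refine EMetric.mem_closure_iff.2 fun ε hε => ?_
  obtain ⟨δ, hδ, hδε⟩ := exists_between hε
  obtain ⟨g, hgξ⟩ :=
    (Lp.memLp ξ).exists_compactlySupported_eLpNorm_sub_le (by simp) hδ.ne'
  refine ⟨_, ⟨g, rfl⟩, ?_⟩
  refine lt_of_le_of_lt ?_ hδε
  rw [Lp.edist_def]
  refine le_trans (le_of_eq (eLpNorm_congr_ae ?_)) hgξ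
  filter_upwards [hlam.coeFn_toL2 g x] with γ hγ
  simp only [Pi.sub_apply, hγ]

theorem inner_toL2 (hlam : 𝒢.IsHaarSystem lam) (ξ η : C_c(G, ℂ)) (x : X) :
    inner ℂ (hlam.toL2 ξ x) (hlam.toL2 η x) = ∫ γ, η γ * (starRingEnd ℂ) (ξ γ) ∂(lam x) := by
  rw [L2.inner_def]
  refine integral_congr_ae ?_
  filter_upwards [hlam.coeFn_toL2 ξ x, hlam.coeFn_toL2 η x] with γ h1 h2
  rw [h1, h2]
  rfl

theorem norm_sq_toL2 (hlam : 𝒢.IsHaarSystem lam) (ξ : C_c(G, ℂ)) (x : X) :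
    ‖hlam.toL2 ξ x‖ ^ 2 = ∫ γ, ‖ξ γ‖ ^ 2 ∂(lam x) := by
  have h := hlam.inner_toL2 ξ ξ x
  rw [inner_self_eq_norm_sq_to_K] at h
  simp only [Complex.mul_conj, Complex.normSq_eq_norm_sq] at h
  rw [integral_complex_ofReal] at h
  refine Complex.ofReal_injective (Eq.trans ?_ h)
  push_cast
  rfl

theorem continuous_integral_real (hlam : 𝒢.IsHaarSystem lam) {φ : G → ℝ} (hφ : Continuous φ)
    (hφc : HasCompactSupport φ) : Continuous fun x => ∫ γ, φ γ ∂(lam x) := by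
  have h := hlam.continuous_integral
    ⟨⟨fun γ => (φ γ : ℂ), by fun_prop⟩, hφc.comp_left (g := ((↑) : ℝ → ℂ)) rfl⟩
  have h2 : (fun x => ∫ γ, φ γ ∂(lam x)) = fun x => (∫ γ, (φ γ : ℂ) ∂(lam x)).re := by
    funext x
    rw [integral_complex_ofReal, Complex.ofReal_re]
  rw [h2]
  exact Complex.continuous_re.comp h

/-- The Haar system axiom applied to `|ξ|²`. This is the source of all semicontinuity below. -/
theorem continuous_norm_toL2 (hlam : 𝒢.IsHaarSystem lam) (ξ : C_c(G, ℂ)) :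
    Continuous fun x => ‖hlam.toL2 ξ x‖ := by
  have h : (fun x => ‖hlam.toL2 ξ x‖) = fun x => √(∫ γ, ‖ξ γ‖ ^ 2 ∂(lam x)) := by
    funext x
    rw [← hlam.norm_sq_toL2, Real.sqrt_sq (norm_nonneg _)]
  rw [h]
  refine Real.continuous_sqrt.comp (hlam.continuous_integral_real (by fun_prop) ?_)
  exact ξ.hasCompactSupport.comp_left (g := fun z : ℂ => ‖z‖ ^ 2) (by simp)

/-- Left translation is controlled only on one range fibre; that fibre is closed and carries the
measure. -/
theorem aemeasurable_mul (hlam : 𝒢.IsHaarSystem lam) (γ : G) :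
    AEMeasurable (𝒢.mul γ) (lam (𝒢.s γ)) := by
  have := 𝒢.t2Space_units
  have hcl : IsClosed {γ₁ | 𝒢.s γ = 𝒢.r γ₁} := isClosed_eq continuous_const 𝒢.continuous_r
  have h := (𝒢.continuousOn_mul_left γ).aemeasurable hcl.measurableSet (μ := lam (𝒢.s γ))
  rwa [Measure.restrict_eq_self_of_ae_mem] at h
  filter_upwards [hlam.ae_r_eq (𝒢.s γ)] with γ₁ h using h.symm

theorem integral_translate (hlam : 𝒢.IsHaarSystem lam) {φ : G → ℝ} (hφ : Continuous φ) (γ : G) :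
    ∫ γ₁, φ (𝒢.mul (𝒢.inv γ) γ₁) ∂(lam (𝒢.r γ)) = ∫ γ₁, φ γ₁ ∂(lam (𝒢.s γ)) := by
  have h1 := hlam.map_mul (𝒢.inv γ)
  have h2 := hlam.aemeasurable_mul (𝒢.inv γ)
  rw [𝒢.s_inv, 𝒢.r_inv] at h1
  rw [𝒢.s_inv] at h2
  rw [← h1, integral_map h2 hφ.measurable.aestronglyMeasurable]

/-- **Fubini's theorem** for a compactly supported continuous function on `G^x × G^x`. -/
theorem integral_integral_swap (hlam : 𝒢.IsHaarSystem lam) (x : X) {k : G → G → ℂ} {K : Set (G × G)}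
    (hK : IsCompact K)
    (hk : ContinuousOn (Function.uncurry k) {p : G × G | 𝒢.r p.1 = x ∧ 𝒢.r p.2 = x})
    (hkK : ∀ p : G × G, 𝒢.r p.1 = x → 𝒢.r p.2 = x → p ∉ K → k p.1 p.2 = 0) :
    ∫ γ, ∫ γ₁, k γ γ₁ ∂(lam x) ∂(lam x) = ∫ γ₁, ∫ γ, k γ γ₁ ∂(lam x) ∂(lam x) := by
  have := 𝒢.t2Space_units
  have := hlam.regular x
  -- The kernel is extended to an element of `C_c(G × G)`: Fubini for compactly supported continuous
  -- functions does not ask `λ^x` to be σ-finite.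
  obtain ⟨g, hg⟩ := exists_compactlySupported_eqOn
    ((isClosed_eq (𝒢.continuous_r.comp continuous_fst) continuous_const).inter
      (isClosed_eq (𝒢.continuous_r.comp continuous_snd) (continuous_const (y := x)))) hK hk
    fun p hp h => hkK p hp.1 hp.2 h
  have key := integral_integral_swap_of_hasCompactSupport (f := fun γ γ₁ => g (γ, γ₁))
    (μ := lam x) (ν := lam x) g.continuous g.hasCompactSupport
  have hx := hlam.ae_r_eq x
  have e1 : ∫ γ, ∫ γ₁, k γ γ₁ ∂(lam x) ∂(lam x) = ∫ γ, ∫ γ₁, g (γ, γ₁) ∂(lam x) ∂(lam x) := by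
    refine integral_congr_ae ?_
    filter_upwards [hx] with γ hγ
    refine integral_congr_ae ?_
    filter_upwards [hx] with γ₁ hγ₁
    exact (hg (γ, γ₁) ⟨hγ, hγ₁⟩).symm
  have e2 : ∫ γ₁, ∫ γ, k γ γ₁ ∂(lam x) ∂(lam x) = ∫ γ₁, ∫ γ, g (γ, γ₁) ∂(lam x) ∂(lam x) := by
    refine integral_congr_ae ?_
    filter_upwards [hx] with γ₁ hγ₁
    refine integral_congr_ae ?_
    filter_upwards [hx] with γ hγ
    exact (hg (γ, γ₁) ⟨hγ, hγ₁⟩).symm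
  rw [e1, e2, key]

end IsHaarSystem

end Fibre

end TopologicalGroupoid

namespace TopologicalGroupoid

/-! ### Convolution of compactly supported functions -/

section Convolution

open Filter

variable {G : Type u} {X : Type v} [TopologicalSpace G] [TopologicalSpace X]
  [LocallyCompactSpace G] [T2Space G] [MeasurableSpace G] [BorelSpace G]
  {𝒢 : TopologicalGroupoid G X} {lam : X → Measure G}

namespace IsHaarSystem

theorem integral_conv_eq (hlam : 𝒢.IsHaarSystem lam) {f g : C_c(G, ℂ)} (ξ : C_c(G, ℂ)) {γ : G}
    (hg : ∀ γ₁, 𝒢.r γ₁ = 𝒢.r γ → g γ₁ = f (𝒢.mul (𝒢.inv γ) γ₁)) :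
    (fun γ₁ => f (𝒢.mul (𝒢.inv γ) γ₁) * ξ γ₁) =ᵐ[lam (𝒢.r γ)] ⇑(g * ξ) := by
  filter_upwards [hlam.ae_r_eq (𝒢.r γ)] with γ₁ h
  rw [CompactlySupportedContinuousMap.mul_apply, hg γ₁ h]

theorem integrable_conv (hlam : 𝒢.IsHaarSystem lam) (f ξ : C_c(G, ℂ)) (γ : G) :
    Integrable (fun γ₁ => f (𝒢.mul (𝒢.inv γ) γ₁) * ξ γ₁) (lam (𝒢.r γ)) := by
  obtain ⟨g, hg⟩ := 𝒢.exists_translate f γ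
  exact (hlam.integrable (g * ξ) _).congr (hlam.integral_conv_eq ξ hg).symm

/-- The translate of `f` is frozen at `γ₀`, giving a fixed `g ∈ C_c(G)`. For `γ` near `γ₀` the true
integrand is uniformly close to `g ξ` over the compact support of `ξ`, and `x ↦ ∫ g ξ dλ^x` is
continuous by the Haar system axiom. -/
theorem continuous_conv (hlam : 𝒢.IsHaarSystem lam) (f ξ : C_c(G, ℂ)) :
    Continuous fun γ => ∫ γ₁, f (𝒢.mul (𝒢.inv γ) γ₁) * ξ γ₁ ∂(lam (𝒢.r γ)) := by
  have := 𝒢.t2Space_units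
  rw [continuous_iff_continuousAt]
  intro γ₀
  obtain ⟨g, hg⟩ := 𝒢.exists_translate f γ₀
  -- `ψ` is `1` on the support of `ξ`, so a uniform error `ε` integrates to at most `ε * M x`, where
  -- `M` is continuous and hence locally bounded.
  obtain ⟨ψ, hψ1, -, hψc, hψ⟩ := exists_continuous_one_zero_of_isCompact
    ξ.hasCompactSupport.isCompact isClosed_empty (Set.disjoint_empty _)
  have hM := hlam.continuous_integral_real ψ.continuous hψc
  set M : X → ℝ := fun x => ∫ γ, ψ γ ∂(lam x) with hMdef
  have hM0 : ∀ x, 0 ≤ M x := fun x => integral_nonneg fun γ => (hψ γ).1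
  have hψi : ∀ x, Integrable ψ (lam x) := fun x => by
    have := hlam.regular x
    exact ψ.continuous.integrable_of_hasCompactSupport hψc
  have tube : ∀ ε > 0, ∀ᶠ γ in 𝓝 γ₀, ∀ γ₁ ∈ tsupport ξ, 𝒢.r γ = 𝒢.r γ₁ →
      ‖f (𝒢.mul (𝒢.inv γ) γ₁) * ξ γ₁ - (g * ξ) γ₁‖ < ε := by
    intro ε hε
    refine ξ.hasCompactSupport.isCompact.eventually_forall_of_forall_eventually
      fun y _ => ?_
    by_cases hy : 𝒢.r γ₀ = 𝒢.r y
    · have hc : ContinuousOn (fun p : G × G => ‖f (𝒢.mul (𝒢.inv p.1) p.2) * ξ p.2 - (g * ξ) p.2‖)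
          {p | 𝒢.r p.1 = 𝒢.r p.2} :=
        (((f.continuous.comp_continuousOn 𝒢.continuousOn_inv_mul).mul
          (ξ.continuous.comp continuous_snd).continuousOn).sub
          ((g * ξ).continuous.comp continuous_snd).continuousOn).norm
      have h0 := hc (γ₀, y) hy
      have h1 : ‖f (𝒢.mul (𝒢.inv γ₀) y) * ξ y - (g * ξ) y‖ < ε := by
        rw [CompactlySupportedContinuousMap.mul_apply, hg y hy.symm, sub_self, norm_zero]
        exact hε
      exact eventually_nhdsWithin_iff.1 (h0.eventually_lt_const h1)
    -- If `γ₀` and `y` lie over different units, so do all nearby pairs, and the condition is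
    -- vacuous.
    · have h0 : ∀ᶠ p : G × G in 𝓝 (γ₀, y), 𝒢.r p.1 ≠ 𝒢.r p.2 :=
        (isOpen_ne_fun (𝒢.continuous_r.comp continuous_fst)
          (𝒢.continuous_r.comp continuous_snd)).mem_nhds hy
      filter_upwards [h0] with p hp h using absurd h hp
  have bound : ∀ ε > 0, ∀ᶠ γ in 𝓝 γ₀,
      ‖(∫ γ₁, f (𝒢.mul (𝒢.inv γ) γ₁) * ξ γ₁ ∂(lam (𝒢.r γ))) - ∫ γ₁, (g * ξ) γ₁ ∂(lam (𝒢.r γ))‖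
        ≤ ε * M (𝒢.r γ) := by
    intro ε hε
    filter_upwards [tube ε hε] with γ hγ
    rw [← integral_sub (hlam.integrable_conv f ξ γ) (hlam.integrable (g * ξ) _), hMdef]
    simp only
    rw [← integral_const_mul]
    refine norm_integral_le_of_norm_le ((hψi _).const_mul ε) ?_
    filter_upwards [hlam.ae_r_eq (𝒢.r γ)] with γ₁ h
    by_cases hγ₁ : γ₁ ∈ tsupport ξ
    · rw [hψ1 hγ₁, Pi.one_apply, mul_one]
      exact (hγ γ₁ hγ₁ h.symm).le
    · rw [CompactlySupportedContinuousMap.mul_apply, image_eq_zero_of_notMem_tsupport hγ₁, mul_zero,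
        mul_zero, sub_zero, norm_zero]
      exact mul_nonneg hε.le (hψ γ₁).1
  have hg0 : ∫ γ₁, f (𝒢.mul (𝒢.inv γ₀) γ₁) * ξ γ₁ ∂(lam (𝒢.r γ₀))
      = ∫ γ₁, (g * ξ) γ₁ ∂(lam (𝒢.r γ₀)) := integral_congr_ae (hlam.integral_conv_eq ξ hg)
  have hlim : Tendsto (fun γ => (∫ γ₁, f (𝒢.mul (𝒢.inv γ) γ₁) * ξ γ₁ ∂(lam (𝒢.r γ)))
      - ∫ γ₁, (g * ξ) γ₁ ∂(lam (𝒢.r γ))) (𝓝 γ₀) (𝓝 0) := by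
    rw [Metric.tendsto_nhds]
    intro δ hδ
    have hM1 : 0 < M (𝒢.r γ₀) + 1 := by linarith [hM0 (𝒢.r γ₀)]
    have hMγ : ∀ᶠ γ in 𝓝 γ₀, M (𝒢.r γ) < M (𝒢.r γ₀) + 1 :=
      (hM.comp 𝒢.continuous_r).continuousAt.eventually_lt_const (by simp)
    filter_upwards [bound (δ / (M (𝒢.r γ₀) + 1)) (div_pos hδ hM1), hMγ] with γ h1 h2
    rw [dist_zero_right]
    refine h1.trans_lt ?_
    calc δ / (M (𝒢.r γ₀) + 1) * M (𝒢.r γ) < δ / (M (𝒢.r γ₀) + 1) * (M (𝒢.r γ₀) + 1) :=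
          mul_lt_mul_of_pos_left h2 (div_pos hδ hM1)
      _ = δ := div_mul_cancel₀ _ hM1.ne'
  have h2 : Tendsto (fun γ => ∫ γ₁, (g * ξ) γ₁ ∂(lam (𝒢.r γ))) (𝓝 γ₀)
      (𝓝 (∫ γ₁, (g * ξ) γ₁ ∂(lam (𝒢.r γ₀)))) :=
    ((hlam.continuous_integral (g * ξ)).comp 𝒢.continuous_r).continuousAt
  have h3 := hlim.add h2
  simp only [sub_add_cancel, zero_add] at h3
  rw [← hg0] at h3
  exact h3

/-- The function `γ ↦ ∫ f(γ⁻¹ γ₁) ξ(γ₁) dλ^{r γ}(γ₁)`. -/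
noncomputable def conv (hlam : 𝒢.IsHaarSystem lam) (f ξ : C_c(G, ℂ)) : C_c(G, ℂ) where
  toFun γ := ∫ γ₁, f (𝒢.mul (𝒢.inv γ) γ₁) * ξ γ₁ ∂(lam (𝒢.r γ))
  continuous_toFun := hlam.continuous_conv f ξ
  hasCompactSupport' := by
    refine HasCompactSupport.intro (𝒢.isCompact_mulSet ξ.hasCompactSupport.isCompact
      (f.hasCompactSupport.isCompact.image 𝒢.continuous_inv)) fun γ hγ => ?_
    refine integral_eq_zero_of_ae ?_
    filter_upwards [hlam.ae_r_eq (𝒢.r γ)] with γ₁ h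
    by_contra h0
    have h1 := mul_ne_zero_iff.1 h0
    exact hγ (𝒢.mem_mulSet_inv h.symm (subset_tsupport _ h1.2) (subset_tsupport _ h1.1))

theorem conv_apply (hlam : 𝒢.IsHaarSystem lam) (f ξ : C_c(G, ℂ)) (γ : G) :
    hlam.conv f ξ γ = ∫ γ₁, f (𝒢.mul (𝒢.inv γ) γ₁) * ξ γ₁ ∂(lam (𝒢.r γ)) := rfl

theorem conv_add (hlam : 𝒢.IsHaarSystem lam) (f ξ η : C_c(G, ℂ)) :
    hlam.conv f (ξ + η) = hlam.conv f ξ + hlam.conv f η := by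
  ext γ
  simp only [conv_apply, CompactlySupportedContinuousMap.add_apply, mul_add]
  exact integral_add (hlam.integrable_conv f ξ γ) (hlam.integrable_conv f η γ)

theorem conv_smul (hlam : 𝒢.IsHaarSystem lam) (f : C_c(G, ℂ)) (c : ℂ) (ξ : C_c(G, ℂ)) :
    hlam.conv f (c • ξ) = c • hlam.conv f ξ := by
  ext γ
  simp only [conv_apply, CompactlySupportedContinuousMap.smul_apply, smul_eq_mul,
    mul_left_comm _ c]
  exact integral_const_mul _ _

theorem toL2_add (hlam : 𝒢.IsHaarSystem lam) (ξ η : C_c(G, ℂ)) (x : X) :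
    hlam.toL2 (ξ + η) x = hlam.toL2 ξ x + hlam.toL2 η x := rfl

theorem toL2_smul (hlam : 𝒢.IsHaarSystem lam) (c : ℂ) (ξ : C_c(G, ℂ)) (x : X) :
    hlam.toL2 (c • ξ) x = c • hlam.toL2 ξ x := rfl

/-- `toL2` as a linear map. -/
noncomputable def toL2ₗ (hlam : 𝒢.IsHaarSystem lam) (x : X) : C_c(G, ℂ) →ₗ[ℂ] Lp ℂ 2 (lam x) where
  toFun ξ := hlam.toL2 ξ x
  map_add' ξ η := hlam.toL2_add ξ η x
  map_smul' c ξ := hlam.toL2_smul c ξ x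

/-- `conv f` as a linear map. -/
noncomputable def convₗ (hlam : 𝒢.IsHaarSystem lam) (f : C_c(G, ℂ)) :
    C_c(G, ℂ) →ₗ[ℂ] C_c(G, ℂ) where
  toFun := hlam.conv f
  map_add' := hlam.conv_add f
  map_smul' := hlam.conv_smul f

/-- The function `x ↦ ∫ φ dλ^x` is continuous and vanishes off the compact set `r(supp φ)`. -/
theorem exists_integral_le (hlam : 𝒢.IsHaarSystem lam) {φ : G → ℝ} (hφ : Continuous φ)
    (hφc : HasCompactSupport φ) : ∃ C, ∀ x, ∫ γ, φ γ ∂(lam x) ≤ C := by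
  have := 𝒢.t2Space_units
  obtain ⟨C, hC⟩ := (hlam.continuous_integral_real hφ hφc).bounded_above_of_compact_support
    (HasCompactSupport.intro (hφc.isCompact.image 𝒢.continuous_r) fun x hx => by
      refine integral_eq_zero_of_ae ?_
      filter_upwards [hlam.ae_r_eq x] with γ hγ
      by_contra h0
      exact hx ⟨γ, subset_tsupport _ h0, hγ⟩)
  exact ⟨C, fun x => (le_abs_self _).trans (hC x)⟩

end IsHaarSystem

/-- The homeomorphism `γ ↦ γ⁻¹`. -/
def invHomeomorph (𝒢 : TopologicalGroupoid G X) : G ≃ₜ G where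
  toFun := 𝒢.inv
  invFun := 𝒢.inv
  left_inv := 𝒢.inv_inv'
  right_inv := 𝒢.inv_inv'
  continuous_toFun := 𝒢.continuous_inv
  continuous_invFun := 𝒢.continuous_inv

/-- The adjoint `f*(γ) = conj f(γ⁻¹)`. -/
noncomputable def adjointFun (𝒢 : TopologicalGroupoid G X) (f : C_c(G, ℂ)) : C_c(G, ℂ) where
  toFun γ := (starRingEnd ℂ) (f (𝒢.inv γ))
  continuous_toFun := Complex.continuous_conj.comp (f.continuous.comp 𝒢.continuous_inv)
  hasCompactSupport' := (f.hasCompactSupport.comp_homeomorph 𝒢.invHomeomorph).comp_left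
    (g := starRingEnd ℂ) (map_zero _)

theorem adjointFun_apply (𝒢 : TopologicalGroupoid G X) (f : C_c(G, ℂ)) (γ : G) :
    𝒢.adjointFun f γ = (starRingEnd ℂ) (f (𝒢.inv γ)) := rfl

namespace IsHaarSystem

/-- A positive bound for the `I`-norm of a compactly supported continuous function. -/
theorem exists_integral_norm_le (hlam : 𝒢.IsHaarSystem lam) (f : C_c(G, ℂ)) :
    ∃ C > 0, ∀ γ, ∫ γ₁, ‖f (𝒢.mul (𝒢.inv γ) γ₁)‖ ∂(lam (𝒢.r γ)) ≤ C ∧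
      ∫ γ₁, ‖f (𝒢.mul (𝒢.inv γ₁) γ)‖ ∂(lam (𝒢.r γ)) ≤ C := by
  have aux (f : C_c(G, ℂ)) : ∃ C, ∀ γ, ∫ γ₁, ‖f (𝒢.mul (𝒢.inv γ) γ₁)‖ ∂(lam (𝒢.r γ)) ≤ C := by
    obtain ⟨C, hC⟩ := hlam.exists_integral_le (φ := fun γ => ‖f γ‖) (by fun_prop)
      f.hasCompactSupport.norm
    refine ⟨C, fun γ => ?_⟩
    rw [hlam.integral_translate (φ := fun γ => ‖f γ‖) (by fun_prop) γ]
    exact hC _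
  obtain ⟨C₁, hC₁⟩ := aux f
  -- Integrating over the other variable amounts to exchanging `f` for `f*`. The maximum with `1`
  -- below keeps the bound positive, since it is later divided by.
  obtain ⟨C₂, hC₂⟩ := aux (𝒢.adjointFun f)
  refine ⟨max 1 (max C₁ C₂), by positivity, fun γ => ⟨?_, ?_⟩⟩
  · exact (hC₁ γ).trans ((le_max_left _ _).trans (le_max_right _ _))
  · refine le_trans (le_of_eq ?_) ((hC₂ γ).trans ((le_max_right _ _).trans (le_max_right _ _)))
    refine integral_congr_ae ?_
    filter_upwards [hlam.ae_r_eq (𝒢.r γ)] with γ₁ h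
    rw [adjointFun_apply, 𝒢.inv_inv_mul h.symm, RCLike.norm_conj]

/-- Fubini's theorem for the kernel `f(γ⁻¹ γ₁) ξ(γ₁) η(γ)`. -/
theorem integral_conv_swap (hlam : 𝒢.IsHaarSystem lam) (f ξ : C_c(G, ℂ)) {η : G → ℂ}
    (hη : Continuous η) (x : X) :
    ∫ γ, hlam.conv f ξ γ * η γ ∂(lam x) =
      ∫ γ₁, ξ γ₁ * ∫ γ, f (𝒢.mul (𝒢.inv γ) γ₁) * η γ ∂(lam x) ∂(lam x) := by
  have h1 : ∫ γ, hlam.conv f ξ γ * η γ ∂(lam x) =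
      ∫ γ, ∫ γ₁, f (𝒢.mul (𝒢.inv γ) γ₁) * ξ γ₁ * η γ ∂(lam x) ∂(lam x) := by
    refine integral_congr_ae ?_
    filter_upwards [hlam.ae_r_eq x] with γ hγ
    rw [integral_mul_const, conv_apply, hγ]
  have h2 : ∫ γ₁, ξ γ₁ * ∫ γ, f (𝒢.mul (𝒢.inv γ) γ₁) * η γ ∂(lam x) ∂(lam x) =
      ∫ γ₁, ∫ γ, f (𝒢.mul (𝒢.inv γ) γ₁) * ξ γ₁ * η γ ∂(lam x) ∂(lam x) := by
    refine integral_congr_ae (Eventually.of_forall fun γ₁ => ?_)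
    simp only
    rw [← integral_const_mul]
    congr 1
    funext γ
    ring
  rw [h1, h2]
  refine hlam.integral_integral_swap x (K := 𝒢.mulSet (tsupport ξ) (𝒢.inv '' tsupport f) ×ˢ
    tsupport ξ) ((𝒢.isCompact_mulSet ξ.hasCompactSupport.isCompact
      (f.hasCompactSupport.isCompact.image 𝒢.continuous_inv)).prod
      ξ.hasCompactSupport.isCompact) ?_ ?_
  · refine ((f.continuous.comp_continuousOn (𝒢.continuousOn_inv_mul.mono ?_)).mul
      (ξ.continuous.comp continuous_snd).continuousOn).mul (hη.comp continuous_fst).continuousOn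
    intro p hp
    exact hp.1.trans hp.2.symm
  · intro p hp1 hp2 hp
    by_contra h0
    have h1 := mul_ne_zero_iff.1 (mul_ne_zero_iff.1 h0).1
    exact hp ⟨𝒢.mem_mulSet_inv (hp1.trans hp2.symm) (subset_tsupport _ h1.2)
      (subset_tsupport _ h1.1), subset_tsupport _ h1.2⟩

end IsHaarSystem

end Convolution

end TopologicalGroupoid

namespace TopologicalGroupoid

/-! ### The operators `Λ_x(f)`: boundedness, integral formula, adjoint -/

section RegularRepresentation

open Filter

variable {G : Type u} {X : Type v} [TopologicalSpace G] [TopologicalSpace X]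
  [LocallyCompactSpace G] [T2Space G] [MeasurableSpace G] [BorelSpace G]
  {𝒢 : TopologicalGroupoid G X} {lam : X → Measure G}

namespace IsHaarSystem

/-- Schur's test: the kernel `f(γ⁻¹ γ₁)` has integral at most `C` in absolute value in either
variable. The proof bounds `|conv f ξ|²` pointwise by `C * I`, then integrates `I` by Fubini. -/
theorem exists_norm_conv_le (hlam : 𝒢.IsHaarSystem lam) (f : C_c(G, ℂ)) :
    ∃ C > 0, ∀ ξ x, ‖hlam.toL2 (hlam.conv f ξ) x‖ ≤ C * ‖hlam.toL2 ξ x‖ := by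
  obtain ⟨C, hC, hfC⟩ := hlam.exists_integral_norm_le f
  refine ⟨C, hC, fun ξ x => ?_⟩
  let f' : C_c(G, ℂ) := ⟨⟨fun γ => ((‖f γ‖ : ℝ) : ℂ), by fun_prop⟩,
    f.hasCompactSupport.comp_left (g := fun z : ℂ => ((‖z‖ : ℝ) : ℂ)) (by simp)⟩
  let ξ' : C_c(G, ℂ) := ⟨⟨fun γ => ((‖ξ γ‖ ^ 2 : ℝ) : ℂ), by fun_prop⟩,
    ξ.hasCompactSupport.comp_left (g := fun z : ℂ => ((‖z‖ ^ 2 : ℝ) : ℂ)) (by simp)⟩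
  let I : G → ℝ := fun γ => ∫ γ₁, ‖f (𝒢.mul (𝒢.inv γ) γ₁)‖ * ‖ξ γ₁‖ ^ 2 ∂(lam (𝒢.r γ))
  have hI : ∀ γ, hlam.conv f' ξ' γ = (I γ : ℂ) := fun γ => by
    rw [conv_apply, ← integral_complex_ofReal]
    refine integral_congr_ae (Eventually.of_forall fun γ₁ => ?_)
    simp [f', ξ']
  have hint1 : ∀ γ, Integrable (fun γ₁ => ‖f (𝒢.mul (𝒢.inv γ) γ₁)‖) (lam (𝒢.r γ)) := fun γ => by
    obtain ⟨g, hg⟩ := 𝒢.exists_translate f γ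
    refine (hlam.integrable g _).norm.congr ?_
    filter_upwards [hlam.ae_r_eq (𝒢.r γ)] with γ₁ h
    rw [hg γ₁ h]
  have hint2 : ∀ γ, Integrable (fun γ₁ => ‖f (𝒢.mul (𝒢.inv γ) γ₁)‖ * ‖ξ γ₁‖ ^ 2)
      (lam (𝒢.r γ)) := fun γ => by
    refine (hlam.integrable_conv f' ξ' γ).re.congr (Eventually.of_forall fun γ₁ => ?_)
    simp only [f', ξ', CompactlySupportedContinuousMap.coe_mk, ContinuousMap.coe_mk]
    rw [← Complex.ofReal_mul]
    exact Complex.ofReal_re _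
  have hpt : ∀ γ, ‖hlam.conv f ξ γ‖ ^ 2 ≤ C * I γ := by
    intro γ
    set t := ‖hlam.conv f ξ γ‖ with ht
    have ht0 : 0 ≤ t := norm_nonneg _
    have h1 : t ^ 2 ≤ ∫ γ₁, t * ‖f (𝒢.mul (𝒢.inv γ) γ₁) * ξ γ₁‖ ∂(lam (𝒢.r γ)) := by
      rw [integral_const_mul, sq]
      exact mul_le_mul_of_nonneg_left (norm_integral_le_integral_norm _) ht0
    have h2 : ∫ γ₁, t * ‖f (𝒢.mul (𝒢.inv γ) γ₁) * ξ γ₁‖ ∂(lam (𝒢.r γ)) ≤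
        ∫ γ₁, (C / 2 * (‖f (𝒢.mul (𝒢.inv γ) γ₁)‖ * ‖ξ γ₁‖ ^ 2) +
          t ^ 2 / (2 * C) * ‖f (𝒢.mul (𝒢.inv γ) γ₁)‖) ∂(lam (𝒢.r γ)) := by
      refine integral_mono ((hlam.integrable_conv f ξ γ).norm.const_mul t)
        (((hint2 γ).const_mul _).add ((hint1 γ).const_mul _)) fun γ₁ => ?_
      simp only [norm_mul]
      set a := ‖f (𝒢.mul (𝒢.inv γ) γ₁)‖
      set b := ‖ξ γ₁‖
      have ha : 0 ≤ a := norm_nonneg _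
      -- The arithmetic-geometric mean inequality replaces Cauchy–Schwarz. Integrated against `a`,
      -- its last term contributes at most `t² / 2`, which is absorbed on the left.
      have key : t * b ≤ C / 2 * b ^ 2 + t ^ 2 / (2 * C) := by
        have : C / 2 * b ^ 2 + t ^ 2 / (2 * C) - t * b = (C * b - t) ^ 2 / (2 * C) := by
          field_simp
          ring
        have h3 : 0 ≤ (C * b - t) ^ 2 / (2 * C) := by positivity
        linarith
      calc t * (a * b) = a * (t * b) := by ring
        _ ≤ a * (C / 2 * b ^ 2 + t ^ 2 / (2 * C)) := mul_le_mul_of_nonneg_left key ha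
        _ = _ := by ring
    have h5 := h1.trans h2
    rw [integral_add ((hint2 γ).const_mul _) ((hint1 γ).const_mul _), integral_const_mul,
      integral_const_mul] at h5
    have h3 : t ^ 2 / (2 * C) * ∫ γ₁, ‖f (𝒢.mul (𝒢.inv γ) γ₁)‖ ∂(lam (𝒢.r γ)) ≤ t ^ 2 / 2 := by
      refine (mul_le_mul_of_nonneg_left (hfC γ).1 (by positivity)).trans (le_of_eq ?_)
      field_simp
    change t ^ 2 ≤ C / 2 * I γ + _ at h5
    linarith
  have hIint : Integrable I (lam x) := by
    refine (hlam.integrable (hlam.conv f' ξ') x).re.congr (Eventually.of_forall fun γ => ?_)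
    simp only [hI]
    exact Complex.ofReal_re _
  have hIle : ∫ γ, I γ ∂(lam x) ≤ C * ∫ γ, ‖ξ γ‖ ^ 2 ∂(lam x) := by
    have e1 : ((∫ γ, I γ ∂(lam x) : ℝ) : ℂ) = ∫ γ, hlam.conv f' ξ' γ * 1 ∂(lam x) := by
      rw [← integral_complex_ofReal]
      simp only [hI, mul_one]
    have e2 : ∫ γ, I γ ∂(lam x) ≤ ‖∫ γ, hlam.conv f' ξ' γ * 1 ∂(lam x)‖ := by
      rw [← e1, Complex.norm_real]
      exact le_abs_self _
    refine e2.trans ?_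
    rw [hlam.integral_conv_swap f' ξ' (η := fun _ => 1) continuous_const x, ← integral_const_mul]
    have hξint : Integrable (fun γ => ‖ξ γ‖ ^ 2) (lam x) := by
      refine (hlam.integrable ξ' x).re.congr (Eventually.of_forall fun γ => ?_)
      exact Complex.ofReal_re _
    refine norm_integral_le_of_norm_le (hξint.const_mul C) ?_
    filter_upwards [hlam.ae_r_eq x] with γ₁ h
    rw [norm_mul, mul_comm]
    have n1 : ‖ξ' γ₁‖ = ‖ξ γ₁‖ ^ 2 := by
      simp [ξ']
    rw [n1]
    refine mul_le_mul_of_nonneg_right ?_ (by positivity)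
    refine (norm_integral_le_integral_norm _).trans ?_
    have := (hfC γ₁).2
    rw [h] at this
    refine le_trans (le_of_eq ?_) this
    congr 1
    funext γ
    simp [f']
  have hfin : ‖hlam.toL2 (hlam.conv f ξ) x‖ ^ 2 ≤ (C * ‖hlam.toL2 ξ x‖) ^ 2 := by
    rw [mul_pow, hlam.norm_sq_toL2, hlam.norm_sq_toL2]
    have : ∫ γ, ‖hlam.conv f ξ γ‖ ^ 2 ∂(lam x) ≤ ∫ γ, C * I γ ∂(lam x) :=
      integral_mono_of_nonneg (Eventually.of_forall fun γ => by positivity) (hIint.const_mul C)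
        (Eventually.of_forall hpt)
    rw [integral_const_mul] at this
    calc _ ≤ _ := this
      _ ≤ C * (C * ∫ γ, ‖ξ γ‖ ^ 2 ∂(lam x)) := mul_le_mul_of_nonneg_left hIle hC.le
      _ = _ := by ring
  exact le_of_sq_le_sq hfin (by positivity)

/-- The integral formula at a fixed `γ` is a bounded functional of `ξ`, so it passes to `L²` limits.
-/
theorem integral_mul_eq_inner (hlam : 𝒢.IsHaarSystem lam) {f g : C_c(G, ℂ)} {γ : G}
    (hg : ∀ γ₁, 𝒢.r γ₁ = 𝒢.r γ → g γ₁ = f (𝒢.mul (𝒢.inv γ) γ₁)) (ξ : Lp ℂ 2 (lam (𝒢.r γ))) :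
    ∫ γ₁, f (𝒢.mul (𝒢.inv γ) γ₁) * ξ γ₁ ∂(lam (𝒢.r γ)) =
      inner ℂ (hlam.toL2 (star g) (𝒢.r γ)) ξ := by
  rw [L2.inner_def]
  refine integral_congr_ae ?_
  filter_upwards [hlam.ae_r_eq (𝒢.r γ), hlam.coeFn_toL2 (star g) (𝒢.r γ)] with γ₁ h h'
  rw [h', CompactlySupportedContinuousMap.star_apply, hg γ₁ h]
  simp [mul_comm]

/-- The operators `Λ_x(f)`. -/
theorem exists_isRegularRep_fibre (hlam : 𝒢.IsHaarSystem lam) (f : C_c(G, ℂ)) :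
    ∃ C, ∀ x, ∃ T : Lp ℂ 2 (lam x) →L[ℂ] Lp ℂ 2 (lam x), ‖T‖ ≤ C ∧
      (∀ ξ, T (hlam.toL2 ξ x) = hlam.toL2 (hlam.conv f ξ) x) ∧
      ∀ ξ : Lp ℂ 2 (lam x),
        (T ξ : G → ℂ) =ᵐ[lam x] fun γ => ∫ γ₁, f (𝒢.mul (𝒢.inv γ) γ₁) * ξ γ₁ ∂(lam x) := by
  obtain ⟨C, hC, hle⟩ := hlam.exists_norm_conv_le f
  refine ⟨C, fun x => ?_⟩
  let T := ((hlam.toL2ₗ x).comp (hlam.convₗ f)).extendOfNorm (hlam.toL2ₗ x)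
  have hT : ∀ ξ, T (hlam.toL2 ξ x) = hlam.toL2 (hlam.conv f ξ) x := fun ξ =>
    LinearMap.extendOfNorm_eq (hlam.denseRange_toL2 x) ⟨C, fun ξ => hle ξ x⟩ ξ
  refine ⟨T, ?_, hT, fun ξ => ?_⟩
  · exact T.opNorm_le_bound hC.le fun ξ =>
      LinearMap.norm_extendOfNorm_apply_le (hlam.denseRange_toL2 x) C (fun ξ => hle ξ x) ξ
  · obtain ⟨s, hs, hsξ⟩ := mem_closure_iff_seq_limit.1 (hlam.denseRange_toL2 x ξ)
    choose η hη using hs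
    have h1 : Tendsto (fun n => T (s n)) atTop (𝓝 (T ξ)) := (T.continuous.tendsto ξ).comp hsξ
    -- The images `T (s n)` converge in `L²`, hence a subsequence converges almost everywhere; its
    -- pointwise limit is identified through the inner product.
    obtain ⟨ns, hns, hlim⟩ := (tendstoInMeasure_of_tendsto_Lp h1).exists_seq_tendsto_ae
    have h2 : ∀ᵐ γ ∂(lam x), ∀ n, T (s n) γ = hlam.conv f (η n) γ := by
      rw [ae_all_iff]
      intro n
      rw [← hη n]
      simp only [hT]
      exact hlam.coeFn_toL2 _ x
    filter_upwards [hlim, h2, hlam.ae_r_eq x] with γ h3 h4 h5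
    subst h5
    obtain ⟨g, hg⟩ := 𝒢.exists_translate f γ
    rw [hlam.integral_mul_eq_inner hg]
    refine tendsto_nhds_unique h3 ?_
    have h6 : ∀ n, T (s n) γ = inner ℂ (hlam.toL2 (star g) (𝒢.r γ)) (s n) := fun n => by
      rw [h4 n, conv_apply, ← hlam.integral_mul_eq_inner hg]
      refine integral_congr_ae ?_
      rw [← hη n]
      filter_upwards [hlam.coeFn_toL2 (η n) (𝒢.r γ)] with γ₁ h7
      rw [h7]
    simp only [h6]
    exact (tendsto_const_nhds.inner hsξ).comp hns.tendsto_atTop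

theorem exists_isRegularRep (hlam : 𝒢.IsHaarSystem lam) (f : C_c(G, ℂ)) :
    ∃ T : FibreOperators lam, 𝒢.IsRegularRep lam f T ∧
      ∀ x ξ, T x (hlam.toL2 ξ x) = hlam.toL2 (hlam.conv f ξ) x := by
  obtain ⟨C, h⟩ := hlam.exists_isRegularRep_fibre f
  choose T hT1 hT2 hT3 using h
  refine ⟨⟨T, memℓp_infty ⟨C, ?_⟩⟩, hT3, hT2⟩
  rintro _ ⟨x, rfl⟩
  exact hT1 x

theorem isRegularRep_toL2 (hlam : 𝒢.IsHaarSystem lam) {f : C_c(G, ℂ)} {T : FibreOperators lam}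
    (hT : 𝒢.IsRegularRep lam f T) (ξ : C_c(G, ℂ)) (x : X) :
    T x (hlam.toL2 ξ x) = hlam.toL2 (hlam.conv f ξ) x := by
  obtain ⟨S, hS, hS'⟩ := hlam.exists_isRegularRep f
  rw [hT.unique hS]
  exact hS' x ξ

/-- Fubini moves the kernel to the second argument, where it becomes `f*(γ⁻¹ γ₁) = conj f(γ₁⁻¹ γ)`.
Thus `Λ(f)* = Λ(f*)` on the dense subspace. -/
theorem inner_conv (hlam : 𝒢.IsHaarSystem lam) (f ξ η : C_c(G, ℂ)) (x : X) :
    inner ℂ (hlam.toL2 (hlam.conv f ξ) x) (hlam.toL2 η x) =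
      inner ℂ (hlam.toL2 ξ x) (hlam.toL2 (hlam.conv (𝒢.adjointFun f) η) x) := by
  rw [← inner_conj_symm, hlam.inner_toL2, hlam.inner_toL2,
    hlam.integral_conv_swap f ξ (η := fun γ => (starRingEnd ℂ) (η γ))
      (Complex.continuous_conj.comp η.continuous) x, ← integral_conj]
  refine integral_congr_ae ?_
  filter_upwards [hlam.ae_r_eq x] with γ h
  rw [RingHom.map_mul, conv_apply, h, mul_comm, ← integral_conj]
  congr 1
  refine integral_congr_ae ?_
  filter_upwards [hlam.ae_r_eq x] with γ₁ h₁
  rw [adjointFun_apply, 𝒢.inv_inv_mul (h.trans h₁.symm)]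
  simp

theorem isRegularRep_star_toL2 (hlam : 𝒢.IsHaarSystem lam) {f : C_c(G, ℂ)} {T : FibreOperators lam}
    (hT : 𝒢.IsRegularRep lam f T) (ξ : C_c(G, ℂ)) (x : X) :
    (star T) x (hlam.toL2 ξ x) = hlam.toL2 (hlam.conv (𝒢.adjointFun f) ξ) x := by
  refine (hlam.denseRange_toL2 x).eq_of_inner_right ℂ fun η => ?_
  rw [lp.star_apply, ContinuousLinearMap.star_eq_adjoint, ContinuousLinearMap.adjoint_inner_right,
    hlam.isRegularRep_toL2 hT, hlam.inner_conv]

end IsHaarSystem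

end RegularRepresentation

end TopologicalGroupoid

namespace TopologicalGroupoid

/-! ### Induction principles for the reduced C*-algebra -/

section ReducedAlgebra

variable {G : Type u} {X : Type v} [TopologicalSpace G] [TopologicalSpace X]
  [MeasurableSpace G] {𝒢 : TopologicalGroupoid G X} {lam : X → Measure G}

noncomputable instance instModuleFibreOperators (lam : X → Measure G) :
    Module ℂ (FibreOperators lam) :=
  lp.instModuleSubtypePreLpMemAddSubgroup

/-- The *-algebra generated by the operators `Λ(f)`. -/
noncomputable def regularAlgebra (𝒢 : TopologicalGroupoid G X) (lam : X → Measure G) :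
    NonUnitalStarSubalgebra ℂ (FibreOperators lam) :=
  NonUnitalStarAlgebra.adjoin ℂ {T | ∃ f : C_c(G, ℂ), 𝒢.IsRegularRep lam f T}

theorem mem_reducedAlgebra_iff {T : FibreOperators lam} :
    T ∈ 𝒢.reducedAlgebra lam ↔ T ∈ closure (𝒢.regularAlgebra lam : Set (FibreOperators lam)) :=
  Iff.rfl

theorem isClosed_reducedAlgebra :
    IsClosed (𝒢.reducedAlgebra lam : Set (FibreOperators lam)) :=
  NonUnitalStarSubalgebra.isClosed_topologicalClosure _

theorem IsRegularRep.mem_regularAlgebra {f : C_c(G, ℂ)} {T : FibreOperators lam}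
    (hT : 𝒢.IsRegularRep lam f T) : T ∈ 𝒢.regularAlgebra lam :=
  NonUnitalStarAlgebra.subset_adjoin ℂ _ ⟨f, hT⟩

theorem IsRegularRep.mem_reducedAlgebra {f : C_c(G, ℂ)} {T : FibreOperators lam}
    (hT : 𝒢.IsRegularRep lam f T) : T ∈ 𝒢.reducedAlgebra lam :=
  subset_closure hT.mem_regularAlgebra

theorem isRegularRep_zero : 𝒢.IsRegularRep lam (0 : C_c(G, ℂ)) 0 := by
  intro x ξ
  simp only [lp.coeFn_zero, Pi.zero_apply, zero_apply,
    CompactlySupportedContinuousMap.coe_zero, zero_mul, integral_zero]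
  exact Lp.coeFn_zero _ _ _

theorem regularAlgebra_induction {P : FibreOperators lam → Prop}
    (gen : ∀ (f : C_c(G, ℂ)) (T), 𝒢.IsRegularRep lam f T → P T)
    (add : ∀ S T, P S → P T → P (S + T))
    (mul : ∀ S ∈ 𝒢.regularAlgebra lam, ∀ T ∈ 𝒢.regularAlgebra lam, P S → P T → P (S * T))
    (smul : ∀ (c : ℂ) (T), P T → P (c • T)) (star : ∀ T, P T → P (star T))
    {T : FibreOperators lam} (hT : T ∈ 𝒢.regularAlgebra lam) : P T := by
  refine NonUnitalStarAlgebra.adjoin_induction ℂ (p := fun T _ => P T) ?_ ?_ ?_ ?_ ?_ ?_ hT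
  · rintro T ⟨f, hf⟩
    exact gen f T hf
  · exact fun S T _ _ => add S T
  -- The zero family is `Λ(0)`, so it needs no separate hypothesis.
  · exact gen 0 0 isRegularRep_zero
  · exact fun S T hS hT => mul S hS T hT
  · exact fun c T _ => smul c T
  · exact fun T _ => star T

theorem reducedAlgebra_induction {P : FibreOperators lam → Prop}
    (closed : IsClosed {T | P T})
    (gen : ∀ (f : C_c(G, ℂ)) (T), 𝒢.IsRegularRep lam f T → P T)
    (add : ∀ S T, P S → P T → P (S + T))
    (mul : ∀ S ∈ 𝒢.reducedAlgebra lam, ∀ T ∈ 𝒢.reducedAlgebra lam, P S → P T → P (S * T))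
    (smul : ∀ (c : ℂ) (T), P T → P (c • T)) (star : ∀ T, P T → P (star T))
    {T : FibreOperators lam} (hT : T ∈ 𝒢.reducedAlgebra lam) : P T :=
  closed.closure_subset_iff.2 (fun _ hS => regularAlgebra_induction gen add
    (fun S hS T hT => mul S (subset_closure hS) T (subset_closure hT)) smul star hS) hT

end ReducedAlgebra

/-! ### Restriction and extension by zero of families of operators -/

section FibreIso

variable {G : Type u} {X : Type v} [TopologicalSpace G] [TopologicalSpace X]
  [LocallyCompactSpace G] [T2Space G] [MeasurableSpace G] [BorelSpace G]
  {𝒢 : TopologicalGroupoid G X} {lam : X → Measure G} {E : Set X}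

namespace IsHaarSystem

theorem _root_.TopologicalGroupoid.measurableEmbedding_val
    (hE : MeasurableSet {γ | 𝒢.r γ ∈ E ∧ 𝒢.s γ ∈ E}) :
    MeasurableEmbedding (Subtype.val : 𝒢.Arrows E → G) :=
  MeasurableEmbedding.subtype_coe hE

variable (hlam : 𝒢.IsHaarSystem lam) (hrs : 𝒢.r = 𝒢.s)
  (hE : MeasurableSet {γ | 𝒢.r γ ∈ E ∧ 𝒢.s γ ∈ E})

include hlam hrs hE

theorem measurePreserving_val (x : E) :
    MeasurePreserving (Subtype.val : 𝒢.Arrows E → G) (𝒢.restrictMeasure lam E x) (lam x) := by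
  refine ⟨measurable_subtype_coe, ?_⟩
  rw [restrictMeasure, (measurableEmbedding_val hE).map_comap]
  refine Measure.restrict_eq_self_of_ae_mem ?_
  filter_upwards [hlam.ae_r_eq x] with γ h
  exact ⟨⟨γ, h ▸ x.2, hrs ▸ h ▸ x.2⟩, rfl⟩

/-- The canonical isomorphism `L²(G, λ^x) ≃ L²(𝒢(E), λ^x)` for `x ∈ E`. -/
noncomputable def fibreEquiv (x : E) :
    Lp ℂ 2 (lam x) ≃ₗᵢ[ℂ] Lp ℂ 2 (𝒢.restrictMeasure lam E x) :=
  LinearIsometryEquiv.ofSurjective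
    (Lp.compMeasurePreservingₗᵢ ℂ Subtype.val (hlam.measurePreserving_val hrs hE x)) (by
      have hemb := measurableEmbedding_val hE
      have hmp := hlam.measurePreserving_val hrs hE x
      intro ξ
      have h1 : MemLp (Function.extend Subtype.val ξ 0) 2 (lam x) := by
        rw [← hmp.map_eq, hemb.memLp_map_measure_iff,
          Function.extend_comp Subtype.val_injective]
        exact Lp.memLp ξ
      refine ⟨h1.toLp, Lp.ext ?_⟩
      refine (Lp.coeFn_compMeasurePreserving _ hmp).trans ?_
      have h2 := hmp.quasiMeasurePreserving.ae_eq_comp h1.coeFn_toLp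
      rwa [Function.extend_comp Subtype.val_injective] at h2)

theorem coeFn_fibreEquiv (x : E) (ξ : Lp ℂ 2 (lam x)) :
    (hlam.fibreEquiv hrs hE x ξ : 𝒢.Arrows E → ℂ) =ᵐ[𝒢.restrictMeasure lam E x]
      fun γ => ξ γ.1 :=
  Lp.coeFn_compMeasurePreserving ξ (hlam.measurePreserving_val hrs hE x)

/-- The inclusion of `𝒢(E)` carries its measure onto `λ^x`, so almost-everywhere statements and
integrals transfer both ways; the two products agree on the fibre over `x`. -/
theorem conj_fibreEquiv_ae_iff {x : E} {f : G → ℂ} {f' : 𝒢.Arrows E → ℂ}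
    (hf : ∀ γ, f' γ = f γ.1) (T : Lp ℂ 2 (lam x) →L[ℂ] Lp ℂ 2 (lam x)) :
    (∀ ξ, ((hlam.fibreEquiv hrs hE x).conjStarAlgEquiv T ξ : 𝒢.Arrows E → ℂ)
        =ᵐ[𝒢.restrictMeasure lam E x] fun γ => ∫ γ₁, f' ((𝒢.restrict E).mul
          ((𝒢.restrict E).inv γ) γ₁) * ξ γ₁ ∂(𝒢.restrictMeasure lam E x)) ↔
      ∀ ξ, (T ξ : G → ℂ) =ᵐ[lam x]
        fun γ => ∫ γ₁, f (𝒢.mul (𝒢.inv γ) γ₁) * ξ γ₁ ∂(lam x) := by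
  have hemb := measurableEmbedding_val hE
  have hmp := hlam.measurePreserving_val hrs hE x
  have hr : ∀ᵐ γ : 𝒢.Arrows E ∂(𝒢.restrictMeasure lam E x), 𝒢.r γ.1 = x :=
    hmp.quasiMeasurePreserving.ae (hlam.ae_r_eq x)
  rw [(hlam.fibreEquiv hrs hE x).surjective.forall]
  refine forall_congr' fun ξ => ?_
  rw [LinearIsometryEquiv.conjStarAlgEquiv_apply_apply, LinearIsometryEquiv.symm_apply_apply]
  have h1 := hlam.coeFn_fibreEquiv hrs hE x (T ξ)
  have h2 : (fun γ => ∫ γ₁, f' ((𝒢.restrict E).mul ((𝒢.restrict E).inv γ) γ₁) *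
      hlam.fibreEquiv hrs hE x ξ γ₁ ∂(𝒢.restrictMeasure lam E x))
      =ᵐ[𝒢.restrictMeasure lam E x]
      fun γ : 𝒢.Arrows E => ∫ γ₁, f (𝒢.mul (𝒢.inv γ.1) γ₁) * ξ γ₁ ∂(lam x) := by
    filter_upwards [hr] with γ hγ
    rw [← hmp.integral_comp hemb fun γ₁ => f (𝒢.mul (𝒢.inv γ.1) γ₁) * ξ γ₁]
    refine integral_congr_ae ?_
    filter_upwards [hr, hlam.coeFn_fibreEquiv hrs hE x ξ] with γ₁ hγ₁ h3
    rw [h3, hf]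
    congr 2
    exact 𝒢.restrictMul_val E ((𝒢.s_inv γ.1).trans (hγ.trans hγ₁.symm))
  have haes : ∀ p : G → Prop, (∀ᵐ γ ∂(lam x), p γ) ↔
      ∀ᵐ γ : 𝒢.Arrows E ∂(𝒢.restrictMeasure lam E x), p γ.1 := fun p => by
    rw [← hemb.ae_map_iff, hmp.map_eq]
  have h4 : ((T ξ : G → ℂ) =ᵐ[lam x] fun γ => ∫ γ₁, f (𝒢.mul (𝒢.inv γ) γ₁) * ξ γ₁ ∂(lam x)) ↔
      (fun γ : 𝒢.Arrows E => (T ξ : G → ℂ) γ.1) =ᵐ[𝒢.restrictMeasure lam E x]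
        fun γ => ∫ γ₁, f (𝒢.mul (𝒢.inv γ.1) γ₁) * ξ γ₁ ∂(lam x) := by
    exact haes _
  rw [h4]
  exact ⟨fun h => h1.symm.trans (h.trans h2), fun h => h1.trans (h.trans h2.symm)⟩

/-- The restriction of a family of operators to `E`. -/
noncomputable def restrictFamily :
    FibreOperators lam →⋆ₙₐ[ℂ] FibreOperators (𝒢.restrictMeasure lam E) where
  toFun T := ⟨fun x => (hlam.fibreEquiv hrs hE x).conjStarAlgEquiv (T x), memℓp_infty (by
    refine ⟨‖T‖, ?_⟩
    rintro _ ⟨x, rfl⟩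
    refine (StarAlgEquiv.norm_map _ _).le.trans (lp.norm_apply_le_norm (by simp) T _))⟩
  map_smul' c T := lp.ext (funext fun x => map_smul _ c (T x))
  map_zero' := lp.ext (funext fun x => map_zero _)
  map_add' S T := lp.ext (funext fun x => map_add _ (S x) (T x))
  map_mul' S T := lp.ext (funext fun x => _root_.map_mul _ (S x) (T x))
  map_star' T := lp.ext (funext fun x => map_star _ (T x))

theorem restrictFamily_apply (T : FibreOperators lam) (x : E) :
    hlam.restrictFamily hrs hE T x = (hlam.fibreEquiv hrs hE x).conjStarAlgEquiv (T x) := rfl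

theorem norm_restrictFamily_apply (T : FibreOperators lam) (x : E) :
    ‖hlam.restrictFamily hrs hE T x‖ = ‖T x‖ :=
  StarAlgEquiv.norm_map _ _

open Classical in
/-- The underlying function of `extendFamily`. -/
noncomputable def extendFamilyFun (T : FibreOperators (𝒢.restrictMeasure lam E)) (x : X) :
    Lp ℂ 2 (lam x) →L[ℂ] Lp ℂ 2 (lam x) :=
  if h : x ∈ E then (hlam.fibreEquiv hrs hE ⟨x, h⟩).conjStarAlgEquiv.symm (T ⟨x, h⟩) else 0

theorem extendFamilyFun_of_mem (T : FibreOperators (𝒢.restrictMeasure lam E)) (x : E) :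
    hlam.extendFamilyFun hrs hE T x = (hlam.fibreEquiv hrs hE x).conjStarAlgEquiv.symm (T x) :=
  dif_pos x.2

theorem extendFamilyFun_of_notMem (T : FibreOperators (𝒢.restrictMeasure lam E)) {x : X}
    (hx : x ∉ E) : hlam.extendFamilyFun hrs hE T x = 0 :=
  dif_neg hx

theorem norm_extendFamilyFun_le (T : FibreOperators (𝒢.restrictMeasure lam E)) (x : X) :
    ‖hlam.extendFamilyFun hrs hE T x‖ ≤ ‖T‖ := by
  by_cases hx : x ∈ E
  · have h1 := hlam.extendFamilyFun_of_mem hrs hE T ⟨x, hx⟩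
    have h2 : ‖(hlam.fibreEquiv hrs hE ⟨x, hx⟩).conjStarAlgEquiv.symm (T ⟨x, hx⟩)‖ =
      ‖T ⟨x, hx⟩‖ := StarAlgEquiv.norm_map _ _
    exact (congrArg norm h1).trans h2 |>.le.trans (lp.norm_apply_le_norm (by simp) T _)
  · rw [hlam.extendFamilyFun_of_notMem hrs hE T hx, norm_zero]
    exact norm_nonneg _

/-- The extension by zero of a family of operators over `E`. -/
noncomputable def extendFamily :
    FibreOperators (𝒢.restrictMeasure lam E) →⋆ₙₐ[ℂ] FibreOperators lam where
  toFun T := ⟨hlam.extendFamilyFun hrs hE T, memℓp_infty (by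
    refine ⟨‖T‖, ?_⟩
    rintro _ ⟨x, rfl⟩
    exact hlam.norm_extendFamilyFun_le hrs hE T x)⟩
  map_smul' c T := lp.ext (funext fun x => by
    by_cases hx : x ∈ E
    · lift x to E using hx
      exact (hlam.extendFamilyFun_of_mem hrs hE _ x).trans ((map_smul _ c (T x)).trans
        (congrArg _ (hlam.extendFamilyFun_of_mem hrs hE T x).symm))
    · exact (hlam.extendFamilyFun_of_notMem hrs hE _ hx).trans
        ((smul_zero c).symm.trans (congrArg _ (hlam.extendFamilyFun_of_notMem hrs hE T hx).symm)))
  map_zero' := lp.ext (funext fun x => by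
    by_cases hx : x ∈ E
    · lift x to E using hx
      exact (hlam.extendFamilyFun_of_mem hrs hE _ x).trans (map_zero _)
    · exact hlam.extendFamilyFun_of_notMem hrs hE _ hx)
  map_add' S T := lp.ext (funext fun x => by
    by_cases hx : x ∈ E
    · lift x to E using hx
      exact (hlam.extendFamilyFun_of_mem hrs hE _ x).trans ((map_add _ (S x) (T x)).trans
        (congrArg₂ _ (hlam.extendFamilyFun_of_mem hrs hE S x).symm
          (hlam.extendFamilyFun_of_mem hrs hE T x).symm))
    · exact (hlam.extendFamilyFun_of_notMem hrs hE _ hx).trans ((add_zero _).symm.trans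
        (congrArg₂ _ (hlam.extendFamilyFun_of_notMem hrs hE S hx).symm
          (hlam.extendFamilyFun_of_notMem hrs hE T hx).symm)))
  map_mul' S T := lp.ext (funext fun x => by
    by_cases hx : x ∈ E
    · lift x to E using hx
      exact (hlam.extendFamilyFun_of_mem hrs hE _ x).trans ((_root_.map_mul _ (S x) (T x)).trans
        (congrArg₂ _ (hlam.extendFamilyFun_of_mem hrs hE S x).symm
          (hlam.extendFamilyFun_of_mem hrs hE T x).symm))
    · exact (hlam.extendFamilyFun_of_notMem hrs hE _ hx).trans ((mul_zero _).symm.trans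
        (congrArg₂ _ (hlam.extendFamilyFun_of_notMem hrs hE S hx).symm
          (hlam.extendFamilyFun_of_notMem hrs hE T hx).symm)))
  map_star' T := lp.ext (funext fun x => by
    by_cases hx : x ∈ E
    · lift x to E using hx
      exact (hlam.extendFamilyFun_of_mem hrs hE _ x).trans ((map_star _ (T x)).trans
        (congrArg _ (hlam.extendFamilyFun_of_mem hrs hE T x).symm))
    · exact (hlam.extendFamilyFun_of_notMem hrs hE _ hx).trans
        ((star_zero _).symm.trans (congrArg _ (hlam.extendFamilyFun_of_notMem hrs hE T hx).symm)))

theorem extendFamily_of_mem (T : FibreOperators (𝒢.restrictMeasure lam E)) (x : E) :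
    hlam.extendFamily hrs hE T x = (hlam.fibreEquiv hrs hE x).conjStarAlgEquiv.symm (T x) :=
  hlam.extendFamilyFun_of_mem hrs hE T x

theorem extendFamily_of_notMem (T : FibreOperators (𝒢.restrictMeasure lam E)) {x : X}
    (hx : x ∉ E) : hlam.extendFamily hrs hE T x = 0 :=
  hlam.extendFamilyFun_of_notMem hrs hE T hx

theorem restrictFamily_extendFamily (T : FibreOperators (𝒢.restrictMeasure lam E)) :
    hlam.restrictFamily hrs hE (hlam.extendFamily hrs hE T) = T := by
  refine lp.ext (funext fun x => ?_)
  rw [restrictFamily_apply, extendFamily_of_mem]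
  exact StarAlgEquiv.apply_symm_apply _ _

theorem extendFamily_restrictFamily {T : FibreOperators lam} (hT : ∀ x ∉ E, T x = 0) :
    hlam.extendFamily hrs hE (hlam.restrictFamily hrs hE T) = T := by
  refine lp.ext (funext fun x => ?_)
  by_cases hx : x ∈ E
  · lift x to E using hx
    rw [extendFamily_of_mem, restrictFamily_apply]
    exact StarAlgEquiv.symm_apply_apply _ _
  · rw [extendFamily_of_notMem hlam hrs hE _ hx, hT x hx]

/-- Extension has restriction as a left inverse, and both are contractive as *-homomorphisms. -/
theorem norm_extendFamily (T : FibreOperators (𝒢.restrictMeasure lam E)) :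
    ‖hlam.extendFamily hrs hE T‖ = ‖T‖ := by
  refine le_antisymm (NonUnitalStarAlgHom.norm_apply_le _ _) ?_
  conv_lhs => rw [← hlam.restrictFamily_extendFamily hrs hE T]
  exact NonUnitalStarAlgHom.norm_apply_le _ _

theorem isRegularRep_restrictFamily {f : G → ℂ} {T : FibreOperators lam}
    (hT : 𝒢.IsRegularRep lam f T) :
    (𝒢.restrict E).IsRegularRep (𝒢.restrictMeasure lam E) (fun γ => f γ.1)
      (hlam.restrictFamily hrs hE T) :=
  fun x => (hlam.conj_fibreEquiv_ae_iff hrs hE (fun _ => rfl) (T x)).2 (hT x)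

theorem isRegularRep_of_restrictFamily {f : G → ℂ} {f' : 𝒢.Arrows E → ℂ} {T : FibreOperators lam}
    (hf : ∀ γ, f' γ = f γ.1) (hf0 : ∀ γ, 𝒢.r γ ∉ E → f γ = 0) (hT0 : ∀ x ∉ E, T x = 0)
    (hT : (𝒢.restrict E).IsRegularRep (𝒢.restrictMeasure lam E) f'
      (hlam.restrictFamily hrs hE T)) : 𝒢.IsRegularRep lam f T := by
  intro x
  by_cases hx : x ∈ E
  · lift x to E using hx
    exact (hlam.conj_fibreEquiv_ae_iff hrs hE hf (T x)).1 (hT x)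
  · intro ξ
    rw [hT0 x hx, zero_apply]
    refine (Lp.coeFn_zero _ _ _).trans ?_
    filter_upwards [hlam.ae_r_eq x] with γ hγ
    refine (integral_eq_zero_of_ae ?_).symm
    filter_upwards [hlam.ae_r_eq x] with γ₁ hγ₁
    rw [hf0, zero_mul, Pi.zero_apply]
    rwa [𝒢.r_inv_mul (hγ.trans hγ₁.symm), ← hrs, hγ]

theorem isRegularRep_extendFamily {f : 𝒢.Arrows E → ℂ}
    {T : FibreOperators (𝒢.restrictMeasure lam E)}
    (hT : (𝒢.restrict E).IsRegularRep (𝒢.restrictMeasure lam E) f T) :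
    𝒢.IsRegularRep lam (Function.extend Subtype.val f 0) (hlam.extendFamily hrs hE T) := by
  refine hlam.isRegularRep_of_restrictFamily hrs hE (f' := f)
    (fun γ => (Subtype.val_injective.extend_apply f 0 γ).symm) (fun γ hγ => ?_)
    (fun x hx => hlam.extendFamily_of_notMem hrs hE T hx) ?_
  · rw [Function.extend_apply' _ _ _ (by rintro ⟨γ', rfl⟩; exact hγ γ'.2.1), Pi.zero_apply]
  · rwa [hlam.restrictFamily_extendFamily hrs hE]

end IsHaarSystem

end FibreIso

end TopologicalGroupoid

/-- The compact set `L` inside `U` lets the cut-off family be supported away from the complement of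
`U`; the bound on `1 - g` keeps the error of the cutoff below the norm of the family. -/
theorem exists_zeroAtInfty_bump {Y : Type*} [TopologicalSpace Y] [T2Space Y]
    [LocallyCompactSpace Y] {K U : Set Y} (hK : IsCompact K) (hU : IsOpen U) (hKU : K ⊆ U) :
    ∃ (g : C₀(Y, ℂ)) (L : Set Y), IsCompact L ∧ L ⊆ U ∧ (∀ y ∈ K, g y = 1) ∧
      (∀ y ∉ L, g y = 0) ∧ ∀ y, ‖1 - g y‖ ≤ 1 := by
  obtain ⟨L, hL, hKL, hLU⟩ := exists_compact_between hK hU hKU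
  obtain ⟨φ, hφ1, hφ0, hφc, hφ⟩ := exists_continuous_one_zero_of_isCompact hK
    (isOpen_interior (s := L)).isClosed_compl (Set.disjoint_compl_right_iff_subset.2 hKL)
  have hc : HasCompactSupport fun y => (φ y : ℂ) := hφc.comp_left (g := ((↑) : ℝ → ℂ)) rfl
  refine ⟨⟨⟨fun y => (φ y : ℂ), by fun_prop⟩, hc.is_zero_at_infty⟩, L, hL, hLU,
    fun y hy => ?_, fun y hy => ?_, fun y => ?_⟩
  · change (φ y : ℂ) = 1
    rw [hφ1 hy]
    simp
  · change (φ y : ℂ) = 0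
    rw [hφ0 fun h => hy (interior_subset h)]
    simp
  · change ‖1 - (φ y : ℂ)‖ ≤ 1
    rw [← Complex.ofReal_one, ← Complex.ofReal_sub, Complex.norm_real, Real.norm_eq_abs, abs_le]
    have := hφ y
    constructor <;> linarith [this.1, this.2]

namespace TopologicalGroupoid

/-! ### The action of `C₀(X)` on families -/

section Families

variable {G : Type u} {X : Type v} [TopologicalSpace G] [TopologicalSpace X] [MeasurableSpace G]
  {lam : X → Measure G}

/-- The action of a function on `X` on families of operators, as a multiplier. -/
noncomputable def diag (lam : X → Measure G) (g : C₀(X, ℂ)) : FibreOperators lam :=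
  ⟨fun x => g x • (1 : Lp ℂ 2 (lam x) →L[ℂ] Lp ℂ 2 (lam x)), memℓp_infty (by
    refine ⟨‖g.toBCF‖, ?_⟩
    rintro _ ⟨x, rfl⟩
    refine (norm_smul_le (g x) (1 : Lp ℂ 2 (lam x) →L[ℂ] Lp ℂ 2 (lam x))).trans ?_
    refine (mul_le_of_le_one_right (norm_nonneg _) ContinuousLinearMap.norm_id_le).trans ?_
    exact g.toBCF.norm_coe_le_norm x)⟩

theorem diag_mul_apply (g : C₀(X, ℂ)) (T : FibreOperators lam) (x : X) :
    (diag lam g * T) x = g x • T x := by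
  rw [lp.infty_coeFn_mul, Pi.mul_apply]
  exact smul_one_mul (g x) (T x)

theorem mul_apply (S T : FibreOperators lam) (x : X) : (S * T) x = S x * T x := by
  rw [lp.infty_coeFn_mul, Pi.mul_apply]

/-- A local unit `h` for `g` lets the cutoff be distributed over both factors, as needed when
neither factor alone is supported in the open set. -/
theorem diag_mul_mul {g h : C₀(X, ℂ)} (hgh : ∀ x, g x ≠ 0 → h x = 1) (S T : FibreOperators lam) :
    diag lam g * (S * T) = (diag lam g * S) * (diag lam h * T) := by
  refine lp.ext (funext fun x => ?_)
  rw [diag_mul_apply, mul_apply, mul_apply, diag_mul_apply, diag_mul_apply, smul_mul_assoc]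
  by_cases hx : g x = 0
  · rw [hx, zero_smul, zero_smul]
  · rw [hgh x hx, one_smul]

theorem diag_mul_star (g : C₀(X, ℂ)) (T : FibreOperators lam) :
    diag lam g * star T = star (diag lam (star g) * T) := by
  refine lp.ext (funext fun x => ?_)
  rw [diag_mul_apply, lp.star_apply, lp.star_apply, diag_mul_apply, star_smul]
  simp

theorem diag_mul_smul (g : C₀(X, ℂ)) (c : ℂ) (T : FibreOperators lam) :
    diag lam g * (c • T) = c • (diag lam g * T) := by
  refine lp.ext (funext fun x => ?_)
  rw [diag_mul_apply]
  refine Eq.trans ?_ (congrArg (c • ·) (diag_mul_apply g T x).symm)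
  exact smul_comm (g x) c (T x)

theorem norm_diag_mul_sub_le {g : C₀(X, ℂ)} {T : FibreOperators lam} {ε : ℝ} (hε : 0 ≤ ε)
    (hg : ∀ x, ‖1 - g x‖ ≤ 1) (h : ∀ x, ε < ‖T x‖ → g x = 1) : ‖T - diag lam g * T‖ ≤ ε := by
  refine lp.norm_le_of_forall_le hε fun x => ?_
  have h1 : (T - diag lam g * T) x = (1 - g x) • T x := by
    rw [sub_smul, one_smul, ← diag_mul_apply]
    rfl
  rw [h1]
  by_cases hx : ε < ‖T x‖
  · rw [h x hx, sub_self, zero_smul, norm_zero]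
    exact hε
  · rw [norm_smul]
    exact (mul_le_of_le_one_left (norm_nonneg _) (hg x)).trans (not_lt.1 hx)

end Families

/-! ### Stability of the reduced algebras under multipliers, restriction and extension -/

section Maps

variable {G : Type u} {X : Type v} [TopologicalSpace G] [TopologicalSpace X]
  [LocallyCompactSpace G] [T2Space G] [MeasurableSpace G] [BorelSpace G]
  {𝒢 : TopologicalGroupoid G X} {lam : X → Measure G} {E : Set X}

theorem isOpen_arrows (hE : IsOpen E) : IsOpen {γ | 𝒢.r γ ∈ E ∧ 𝒢.s γ ∈ E} :=
  (hE.preimage 𝒢.continuous_r).inter (hE.preimage 𝒢.continuous_s)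

theorem isClosed_arrows (hE : IsClosed E) : IsClosed {γ | 𝒢.r γ ∈ E ∧ 𝒢.s γ ∈ E} :=
  (hE.preimage 𝒢.continuous_r).inter (hE.preimage 𝒢.continuous_s)

namespace IsHaarSystem

variable (hlam : 𝒢.IsHaarSystem lam)

include hlam

theorem apply_eq_zero_of_isRegularRep {f : G → ℂ} {T : FibreOperators lam}
    (hT : 𝒢.IsRegularRep lam f T) {x : X} (hrs : 𝒢.r = 𝒢.s) (hf : ∀ γ, 𝒢.r γ = x → f γ = 0) :
    T x = 0 := by
  ext1 ξ
  refine Lp.ext ((hT x ξ).trans ?_)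
  rw [zero_apply]
  refine Filter.EventuallyEq.trans ?_ (Lp.coeFn_zero _ _ _).symm
  filter_upwards [hlam.ae_r_eq x] with γ hγ
  refine integral_eq_zero_of_ae ?_
  filter_upwards [hlam.ae_r_eq x] with γ₁ hγ₁
  rw [hf, zero_mul, Pi.zero_apply]
  rw [𝒢.r_inv_mul (hγ.trans hγ₁.symm), ← hrs, hγ]

/-- As `r = s`, the product `γ⁻¹ γ₁` again lies over `x`, so `g ∘ r` is the constant `g x` in the
integrand and comes out of the integral. -/
theorem isRegularRep_diag_mul (hrs : 𝒢.r = 𝒢.s) {f : G → ℂ} {T : FibreOperators lam}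
    (hT : 𝒢.IsRegularRep lam f T) (g : C₀(X, ℂ)) :
    𝒢.IsRegularRep lam (fun γ => g (𝒢.r γ) * f γ) (diag lam g * T) := by
  intro x ξ
  rw [diag_mul_apply, smul_apply]
  refine (Lp.coeFn_smul _ _).trans ?_
  filter_upwards [hT x ξ, hlam.ae_r_eq x] with γ h hγ
  rw [Pi.smul_apply, h, smul_eq_mul, ← integral_const_mul]
  refine integral_congr_ae ?_
  filter_upwards [hlam.ae_r_eq x] with γ₁ hγ₁
  rw [𝒢.r_inv_mul (hγ.trans hγ₁.symm), ← hrs, hγ, _root_.mul_assoc]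

theorem diag_mul_mem (hrs : 𝒢.r = 𝒢.s) (g : C₀(X, ℂ)) {T : FibreOperators lam}
    (hT : T ∈ 𝒢.reducedAlgebra lam) : diag lam g * T ∈ 𝒢.reducedAlgebra lam := by
  revert g
  refine reducedAlgebra_induction (P := fun T => ∀ g : C₀(X, ℂ), diag lam g * T ∈
    𝒢.reducedAlgebra lam) ?_ ?_ ?_ ?_ ?_ ?_ hT
  · rw [Set.ofPred_forall]
    exact isClosed_iInter fun g => isClosed_reducedAlgebra.preimage (continuous_const_mul _)
  · intro f T hT g
    let f' : C_c(G, ℂ) := ⟨⟨fun γ => g (𝒢.r γ) * f γ,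
      (g.continuous.comp 𝒢.continuous_r).mul f.continuous⟩, f.hasCompactSupport.mul_left⟩
    exact IsRegularRep.mem_reducedAlgebra (f := f') (hlam.isRegularRep_diag_mul hrs hT g)
  · intro S T hS hT g
    rw [mul_add]
    exact add_mem (hS g) (hT g)
  · intro S hS T hT hS' _ g
    rw [← _root_.mul_assoc]
    exact mul_mem (hS' g) hT
  · intro c T hT g
    rw [diag_mul_smul]
    exact SMulMemClass.smul_mem c (hT g)
  · intro T hT g
    rw [diag_mul_star]
    exact star_mem (hT _)

variable (hrs : 𝒢.r = 𝒢.s)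

include hrs

set_option synthInstance.maxHeartbeats 200000 in
theorem restrictFamily_mem (hE : IsClosed E) {T : FibreOperators lam}
    (hT : T ∈ 𝒢.reducedAlgebra lam) :
    hlam.restrictFamily hrs (isClosed_arrows hE).measurableSet T ∈
      (𝒢.restrict E).reducedAlgebra (𝒢.restrictMeasure lam E) := by
  refine reducedAlgebra_induction (P := fun T => hlam.restrictFamily hrs
    (isClosed_arrows hE).measurableSet T ∈ (𝒢.restrict E).reducedAlgebra
      (𝒢.restrictMeasure lam E)) ?_ ?_ ?_ ?_ ?_ ?_ hT
  · exact isClosed_reducedAlgebra.preimage (NonUnitalStarAlgHom.continuous_of_cstar _)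
  · intro f T hT
    let f' : C_c(𝒢.Arrows E, ℂ) := ⟨⟨fun γ => f γ.1, by fun_prop⟩,
      f.hasCompactSupport.comp_isClosedEmbedding (isClosed_arrows hE).isClosedEmbedding_subtypeVal⟩
    exact IsRegularRep.mem_reducedAlgebra (f := f') (hlam.isRegularRep_restrictFamily hrs _ hT)
  · intro S T hS hT
    rw [map_add]
    exact add_mem hS hT
  · intro S _ T _ hS hT
    rw [_root_.map_mul]
    exact mul_mem hS hT
  · intro c T hT
    rw [map_smul]
    exact SMulMemClass.smul_mem c hT
  · intro T hT
    rw [map_star]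
    exact star_mem hT

-- For open `E`, extension by zero keeps a compactly supported function continuous, so generators go
-- to generators. The closed case uses restriction instead.
set_option synthInstance.maxHeartbeats 200000 in
theorem extendFamily_mem (hE : IsOpen E) {T : FibreOperators (𝒢.restrictMeasure lam E)}
    (hT : T ∈ (𝒢.restrict E).reducedAlgebra (𝒢.restrictMeasure lam E)) :
    hlam.extendFamily hrs (isOpen_arrows hE).measurableSet T ∈ 𝒢.reducedAlgebra lam := by
  refine reducedAlgebra_induction (P := fun T => hlam.extendFamily hrs
    (isOpen_arrows hE).measurableSet T ∈ 𝒢.reducedAlgebra lam) ?_ ?_ ?_ ?_ ?_ ?_ hT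
  · exact isClosed_reducedAlgebra.preimage (NonUnitalStarAlgHom.continuous_of_cstar _)
  · intro f T hT
    let f' : C_c(G, ℂ) := ⟨⟨Function.extend Subtype.val f 0,
      HasCompactSupport.continuous_extend_zero (isOpen_arrows hE) f.continuous f.hasCompactSupport⟩,
      f.hasCompactSupport.extend_zero continuous_subtype_val⟩
    exact IsRegularRep.mem_reducedAlgebra (f := f') (hlam.isRegularRep_extendFamily hrs _ hT)
  · intro S T hS hT
    rw [map_add]
    exact add_mem hS hT
  · intro S _ T _ hS hT
    rw [_root_.map_mul]
    exact mul_mem hS hT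
  · intro c T hT
    rw [map_smul]
    exact SMulMemClass.smul_mem c hT
  · intro T hT
    rw [map_star]
    exact star_mem hT

end IsHaarSystem

end Maps

end TopologicalGroupoid

namespace TopologicalGroupoid

/-! ### Semicontinuity and supports of the norm functions -/

section NormFunction

variable {G : Type u} {X : Type v} [TopologicalSpace G] [TopologicalSpace X]
  [LocallyCompactSpace G] [T2Space G] [MeasurableSpace G] [BorelSpace G]
  {𝒢 : TopologicalGroupoid G X} {lam : X → Measure G} {E : Set X}

namespace IsHaarSystem

variable (hlam : 𝒢.IsHaarSystem lam)

include hlam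

/-- The claim is proved for `T` and `star T` together, since for `T` alone it would not survive the
adjoint step of the induction. -/
theorem exists_section_of_mem_regularAlgebra {T : FibreOperators lam}
    (hT : T ∈ 𝒢.regularAlgebra lam) (ξ : C_c(G, ℂ)) :
    ∃ η : C_c(G, ℂ), ∀ x, T x (hlam.toL2 ξ x) = hlam.toL2 η x := by
  suffices h : (∀ ξ : C_c(G, ℂ), ∃ η : C_c(G, ℂ), ∀ x, T x (hlam.toL2 ξ x) = hlam.toL2 η x) ∧
      ∀ ξ : C_c(G, ℂ), ∃ η : C_c(G, ℂ), ∀ x, star T x (hlam.toL2 ξ x) = hlam.toL2 η x from h.1 ξ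
  refine regularAlgebra_induction (P := fun T =>
    (∀ ξ : C_c(G, ℂ), ∃ η : C_c(G, ℂ), ∀ x, T x (hlam.toL2 ξ x) = hlam.toL2 η x) ∧
      ∀ ξ : C_c(G, ℂ), ∃ η : C_c(G, ℂ), ∀ x, star T x (hlam.toL2 ξ x) = hlam.toL2 η x)
    ?_ ?_ ?_ ?_ ?_ hT
  · exact fun f T hT => ⟨fun ξ => ⟨_, fun x => hlam.isRegularRep_toL2 hT ξ x⟩,
      fun ξ => ⟨_, fun x => hlam.isRegularRep_star_toL2 hT ξ x⟩⟩
  · have add : ∀ S T : FibreOperators lam,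
        (∀ ξ : C_c(G, ℂ), ∃ η : C_c(G, ℂ), ∀ x, S x (hlam.toL2 ξ x) = hlam.toL2 η x) →
        (∀ ξ : C_c(G, ℂ), ∃ η : C_c(G, ℂ), ∀ x, T x (hlam.toL2 ξ x) = hlam.toL2 η x) →
        ∀ ξ : C_c(G, ℂ), ∃ η : C_c(G, ℂ), ∀ x, (S + T) x (hlam.toL2 ξ x) = hlam.toL2 η x := by
      intro S T hS hT ξ
      obtain ⟨η, hη⟩ := hS ξ
      obtain ⟨ζ, hζ⟩ := hT ξ
      exact ⟨η + ζ, fun x => (congrArg₂ (· + ·) (hη x) (hζ x)).trans (hlam.toL2_add η ζ x).symm⟩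
    intro S T hS hT
    refine ⟨add S T hS.1 hT.1, ?_⟩
    rw [star_add]
    exact add _ _ hS.2 hT.2
  · have mul : ∀ S T : FibreOperators lam,
        (∀ ξ : C_c(G, ℂ), ∃ η : C_c(G, ℂ), ∀ x, S x (hlam.toL2 ξ x) = hlam.toL2 η x) →
        (∀ ξ : C_c(G, ℂ), ∃ η : C_c(G, ℂ), ∀ x, T x (hlam.toL2 ξ x) = hlam.toL2 η x) →
        ∀ ξ : C_c(G, ℂ), ∃ η : C_c(G, ℂ), ∀ x, (S * T) x (hlam.toL2 ξ x) = hlam.toL2 η x := by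
      intro S T hS hT ξ
      obtain ⟨η, hη⟩ := hT ξ
      obtain ⟨ζ, hζ⟩ := hS η
      exact ⟨ζ, fun x => (congrArg (S x) (hη x)).trans (hζ x)⟩
    intro S _ T _ hS hT
    refine ⟨mul S T hS.1 hT.1, ?_⟩
    rw [star_mul]
    exact mul _ _ hT.2 hS.2
  · intro c T hT
    refine ⟨fun ξ => ?_, fun ξ => ?_⟩
    · obtain ⟨η, hη⟩ := hT.1 ξ
      exact ⟨c • η, fun x => (congrArg (c • ·) (hη x)).trans (hlam.toL2_smul c η x).symm⟩
    · obtain ⟨η, hη⟩ := hT.2 ξ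
      refine ⟨star c • η, fun x => Eq.trans ?_ (hlam.toL2_smul (star c) η x).symm⟩
      rw [← hη x, lp.star_apply, lp.star_apply]
      exact congrArg (fun S : Lp ℂ 2 (lam x) →L[ℂ] Lp ℂ 2 (lam x) => S (hlam.toL2 ξ x))
        (star_smul c (T x))
  · intro T hT
    rw [star_star]
    exact ⟨hT.2, hT.1⟩

/-- Lower semicontinuity of the norm function of an element of the reduced C*-algebra. -/
theorem lowerSemicontinuous_norm {T : FibreOperators lam} (hT : T ∈ 𝒢.reducedAlgebra lam) :
    LowerSemicontinuous fun x => ‖T x‖ := by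
  have key : ∀ S ∈ 𝒢.regularAlgebra lam, LowerSemicontinuous fun x => ‖S x‖ := by
    intro S hS x c hc
    rcases lt_or_ge c 0 with hc0 | hc0
    · exact Filter.Eventually.of_forall fun y => hc0.trans_le (norm_nonneg _)
    obtain ⟨ξ₀, hξ₀⟩ : ∃ ξ₀, c * ‖ξ₀‖ < ‖S x ξ₀‖ := by
      by_contra! h
      exact absurd ((S x).opNorm_le_bound hc0 h) (not_le.2 hc)
    have hopen : IsOpen {ξ : Lp ℂ 2 (lam x) | c * ‖ξ‖ < ‖S x ξ‖} :=
      isOpen_lt (by fun_prop) (by fun_prop)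
    -- The strict inequality is open in the vector, so the witness may be taken in `C_c(G)`. Then
    -- both `‖ξ‖` and `‖S ξ‖` are continuous in the base point, and the inequality persists nearby.
    obtain ⟨ξ, hξ⟩ := (hlam.denseRange_toL2 x).exists_mem_open hopen ⟨ξ₀, hξ₀⟩
    obtain ⟨η, hη⟩ := hlam.exists_section_of_mem_regularAlgebra hS ξ
    have hx : c * ‖hlam.toL2 ξ x‖ < ‖hlam.toL2 η x‖ := by
      rw [← hη x]
      exact hξ
    have hev := (continuous_const.mul (hlam.continuous_norm_toL2 ξ)).continuousAt.eventually_lt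
      (hlam.continuous_norm_toL2 η).continuousAt hx
    filter_upwards [hev] with y hy
    rw [← hη y] at hy
    by_contra! h
    exact absurd (hy.trans_le ((S y).le_of_opNorm_le h _)) (lt_irrefl _)
  intro x c hc
  change c < ‖T x‖ at hc
  obtain ⟨S, hS, hST⟩ := Metric.mem_closure_iff.1 (mem_reducedAlgebra_iff.1 hT)
    ((‖T x‖ - c) / 2) (by linarith)
  rw [dist_eq_norm] at hST
  have hle : ∀ y, ‖T y - S y‖ ≤ ‖T - S‖ := fun y => lp.norm_apply_le_norm (by simp) (T - S) y
  have hx : c + (‖T x‖ - c) / 2 < ‖S x‖ := by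
    have h1 := norm_sub_norm_le (T x) (S x)
    have h2 := hle x
    linarith
  filter_upwards [key S hS x _ hx] with y hy
  have h1 := norm_sub_norm_le (S y) (T y)
  have h2 := hle y
  rw [norm_sub_rev] at h2
  linarith

variable (hrs : 𝒢.r = 𝒢.s)

include hrs

theorem exists_compact_support {T : FibreOperators lam} (hT : T ∈ 𝒢.regularAlgebra lam) :
    ∃ K : Set X, IsCompact K ∧ ∀ x ∉ K, T x = 0 := by
  refine regularAlgebra_induction (P := fun T : FibreOperators lam =>
    ∃ K : Set X, IsCompact K ∧ ∀ x ∉ K, T x = 0) ?_ ?_ ?_ ?_ ?_ hT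
  · intro f T hT
    refine ⟨𝒢.r '' tsupport f, f.hasCompactSupport.isCompact.image 𝒢.continuous_r, fun x hx => ?_⟩
    refine hlam.apply_eq_zero_of_isRegularRep hT hrs fun γ hγ => ?_
    by_contra h0
    exact hx ⟨γ, subset_tsupport _ h0, hγ⟩
  · rintro S T ⟨K, hK, hS⟩ ⟨L, hL, hT⟩
    refine ⟨K ∪ L, hK.union hL, fun x hx => ?_⟩
    rw [lp.coeFn_add, Pi.add_apply, hS x fun h => hx (Or.inl h), hT x fun h => hx (Or.inr h),
      add_zero]
  · rintro S - T - ⟨K, hK, hS⟩ -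
    exact ⟨K, hK, fun x hx => by rw [mul_apply, hS x hx, zero_mul]⟩
  · rintro c T ⟨K, hK, hT⟩
    exact ⟨K, hK, fun x hx => (congrArg (c • ·) (hT x hx)).trans (smul_zero c)⟩
  · rintro T ⟨K, hK, hT⟩
    exact ⟨K, hK, fun x hx => by rw [lp.star_apply, hT x hx, star_zero]⟩

theorem exists_compact_norm_lt {T : FibreOperators lam} (hT : T ∈ 𝒢.reducedAlgebra lam) {ε : ℝ}
    (hε : 0 < ε) : ∃ K : Set X, IsCompact K ∧ ∀ x ∉ K, ‖T x‖ < ε := by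
  obtain ⟨S, hS, hST⟩ := Metric.mem_closure_iff.1 (mem_reducedAlgebra_iff.1 hT) ε hε
  obtain ⟨K, hK, hSK⟩ := hlam.exists_compact_support hrs hS
  refine ⟨K, hK, fun x hx => ?_⟩
  rw [dist_eq_norm] at hST
  have h : ‖T x - S x‖ ≤ ‖T - S‖ := lp.norm_apply_le_norm (by simp) (T - S) x
  rw [hSK x hx, sub_zero] at h
  exact h.trans_lt hST

/-- Compactness inside `E` is the point: such a family, extended by zero, vanishes in a
neighbourhood of every point outside `E`. -/
theorem exists_compact_support_extendFamily (hE : IsOpen E)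
    {T : FibreOperators (𝒢.restrictMeasure lam E)}
    (hT : T ∈ (𝒢.restrict E).regularAlgebra (𝒢.restrictMeasure lam E)) :
    ∃ K : Set X, IsCompact K ∧ K ⊆ E ∧
      ∀ x ∉ K, hlam.extendFamily hrs (isOpen_arrows hE).measurableSet T x = 0 := by
  suffices h : ∃ K : Set X, IsCompact K ∧ K ⊆ E ∧ ∀ x : E, x.1 ∉ K → T x = 0 by
    obtain ⟨K, hK, hKE, h⟩ := h
    refine ⟨K, hK, hKE, fun x hx => ?_⟩
    by_cases hxE : x ∈ E
    · refine (hlam.extendFamily_of_mem hrs (isOpen_arrows hE).measurableSet T ⟨x, hxE⟩).trans ?_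
      rw [h ⟨x, hxE⟩ hx]
      exact map_zero _
    · exact hlam.extendFamily_of_notMem hrs _ T hxE
  refine regularAlgebra_induction (P := fun T : FibreOperators (𝒢.restrictMeasure lam E) =>
    ∃ K : Set X, IsCompact K ∧ K ⊆ E ∧ ∀ x : E, x.1 ∉ K → T x = 0) ?_ ?_ ?_ ?_ ?_ hT
  · intro f T hT
    refine ⟨(fun γ : 𝒢.Arrows E => 𝒢.r γ.1) '' tsupport f,
      f.hasCompactSupport.isCompact.image (𝒢.continuous_r.comp continuous_subtype_val), ?_, ?_⟩
    · rintro _ ⟨γ, -, rfl⟩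
      exact γ.2.1
    · intro x hx
      have h1 := hlam.isRegularRep_extendFamily hrs (isOpen_arrows hE).measurableSet hT
      have h2 := hlam.apply_eq_zero_of_isRegularRep h1 (x := x.1) hrs fun γ hγ => by
        by_contra h0
        by_cases hγE : ∃ γ' : 𝒢.Arrows E, γ'.1 = γ
        · obtain ⟨γ', rfl⟩ := hγE
          rw [Subtype.val_injective.extend_apply] at h0
          exact hx ⟨γ', subset_tsupport _ h0, hγ⟩
        · exact h0 (Function.extend_apply' _ _ _ hγE)
      rw [← hlam.restrictFamily_extendFamily hrs (isOpen_arrows hE).measurableSet T,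
        restrictFamily_apply, h2]
      exact map_zero _
  · rintro S T ⟨K, hK, hKE, hS⟩ ⟨L, hL, hLE, hT⟩
    refine ⟨K ∪ L, hK.union hL, Set.union_subset hKE hLE, fun x hx => ?_⟩
    rw [lp.coeFn_add, Pi.add_apply, hS x fun h => hx (Or.inl h), hT x fun h => hx (Or.inr h),
      add_zero]
  · rintro S - T - ⟨K, hK, hKE, hS⟩ -
    exact ⟨K, hK, hKE, fun x hx => by rw [mul_apply, hS x hx, zero_mul]⟩
  · rintro c T ⟨K, hK, hKE, hT⟩
    exact ⟨K, hK, hKE, fun x hx => (congrArg (c • ·) (hT x hx)).trans (smul_zero c)⟩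
  · rintro T ⟨K, hK, hKE, hT⟩
    exact ⟨K, hK, hKE, fun x hx => by rw [lp.star_apply, hT x hx, star_zero]⟩

set_option maxHeartbeats 1600000 in
set_option synthInstance.maxHeartbeats 200000 in
/-- Multiplication by a function compactly supported in the open set `E` maps the reduced
C*-algebra into the one of the restriction to `E`. -/
theorem restrictFamily_diag_mul_mem (hE : IsOpen E) {T : FibreOperators lam}
    (hT : T ∈ 𝒢.reducedAlgebra lam) {g : C₀(X, ℂ)} {L : Set X} (hL : IsCompact L) (hLE : L ⊆ E)
    (hg : ∀ x ∉ L, g x = 0) :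
    hlam.restrictFamily hrs (isOpen_arrows hE).measurableSet (diag lam g * T) ∈
      (𝒢.restrict E).reducedAlgebra (𝒢.restrictMeasure lam E) := by
  have := 𝒢.t2Space_units
  have := 𝒢.locallyCompactSpace_units
  set R := hlam.restrictFamily hrs (isOpen_arrows hE).measurableSet with hR
  have hRc : Continuous R := NonUnitalStarAlgHom.continuous_of_cstar _
  refine reducedAlgebra_induction (P := fun T => ∀ (g : C₀(X, ℂ)) (L : Set X), IsCompact L →
    L ⊆ E → (∀ x ∉ L, g x = 0) → R (diag lam g * T) ∈
      (𝒢.restrict E).reducedAlgebra (𝒢.restrictMeasure lam E)) ?_ ?_ ?_ ?_ ?_ ?_ hT g L hL hLE hg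
  · simp only [Set.ofPred_forall]
    exact isClosed_iInter fun g => isClosed_iInter fun L => isClosed_iInter fun _ =>
      isClosed_iInter fun _ => isClosed_iInter fun _ =>
        isClosed_reducedAlgebra.preimage (hRc.comp (continuous_const_mul _))
  · intro f T hT g L hL hLE hg
    -- The support of `(g ∘ r) f` lies in this compact set, which is contained in the arrows over
    -- `E`; so its restriction is compactly supported in `𝒢(E)`.
    have hK : IsCompact (tsupport f ∩ 𝒢.r ⁻¹' L) :=
      f.hasCompactSupport.isCompact.inter_right (hL.isClosed.preimage 𝒢.continuous_r)
    have hKE : tsupport f ∩ 𝒢.r ⁻¹' L ⊆ Set.range (Subtype.val : 𝒢.Arrows E → G) := fun γ hγ =>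
      ⟨⟨γ, hLE hγ.2, hrs ▸ hLE hγ.2⟩, rfl⟩
    let f' : C_c(𝒢.Arrows E, ℂ) := ⟨⟨fun γ => g (𝒢.r γ.1) * f γ.1,
      (g.continuous.comp (𝒢.continuous_r.comp continuous_subtype_val)).mul
        (f.continuous.comp continuous_subtype_val)⟩,
      HasCompactSupport.intro ((IsInducing.subtypeVal.isCompact_preimage_iff hKE).2 hK)
        fun γ hγ => by
          by_contra h0
          have h1 := mul_ne_zero_iff.1 h0
          refine hγ ⟨subset_tsupport _ h1.2, ?_⟩
          by_contra h2
          exact h1.1 (hg _ h2)⟩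
    exact IsRegularRep.mem_reducedAlgebra (f := f')
      (hlam.isRegularRep_restrictFamily hrs _ (hlam.isRegularRep_diag_mul hrs hT g))
  · intro S T hS hT g L hL hLE hg
    rw [mul_add, map_add]
    exact add_mem (hS g L hL hLE hg) (hT g L hL hLE hg)
  · intro S _ T _ hS hT g L hL hLE hg
    obtain ⟨h, L', hL', hL'E, h1, h0, -⟩ := exists_zeroAtInfty_bump hL hE hLE
    rw [diag_mul_mul (h := h) (fun x hx => h1 x (by_contra fun hxL => hx (hg x hxL))),
      _root_.map_mul]
    exact mul_mem (hS g L hL hLE hg) (hT h L' hL' hL'E h0)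
  · intro c T hT g L hL hLE hg
    rw [diag_mul_smul, map_smul]
    exact SMulMemClass.smul_mem c (hT g L hL hLE hg)
  · intro T hT g L hL hLE hg
    rw [diag_mul_star, map_star]
    refine star_mem (hT (star g) L hL hLE fun x hx => ?_)
    rw [ZeroAtInftyContinuousMap.star_apply, hg x hx, star_zero]

end IsHaarSystem

end NormFunction

end TopologicalGroupoid

namespace TopologicalGroupoid

/-! ### Uniqueness of *-homomorphisms given on the generators -/

section Hom

variable {G : Type u} {X : Type v} [TopologicalSpace G] [TopologicalSpace X] [MeasurableSpace G]
  {𝒢 : TopologicalGroupoid G X} {lam : X → Measure G}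

namespace ReducedCStar

theorem norm_def (T : 𝒢.ReducedCStar lam) : ‖T‖ = ‖T.1‖ := rfl

theorem sub_val (S T : 𝒢.ReducedCStar lam) : (S - T).1 = S.1 - T.1 := rfl

theorem mul_val (S T : 𝒢.ReducedCStar lam) : (S * T).1 = S.1 * T.1 := rfl

theorem smul_val (c : ℂ) (T : 𝒢.ReducedCStar lam) : (c • T).1 = c • T.1 := rfl

theorem star_val (T : 𝒢.ReducedCStar lam) : (star T).1 = star T.1 := rfl

theorem zero_val : (0 : 𝒢.ReducedCStar lam).1 = 0 := rfl

/-- A family of operators in the reduced C*-algebra, as an element of it. -/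
def ofMem (T : FibreOperators lam) (hT : T ∈ 𝒢.reducedAlgebra lam) : 𝒢.ReducedCStar lam := ⟨T, hT⟩

theorem ofMem_val (T : FibreOperators lam) (hT : T ∈ 𝒢.reducedAlgebra lam) :
    (ofMem T hT).1 = T := rfl

theorem exists_regular_near (T : 𝒢.ReducedCStar lam) {ε : ℝ} (hε : 0 < ε) :
    ∃ S ∈ 𝒢.regularAlgebra lam, ‖T.1 - S‖ < ε := by
  obtain ⟨S, hS, h⟩ := Metric.mem_closure_iff.1 (mem_reducedAlgebra_iff.1 T.2) ε hε
  exact ⟨S, hS, by rwa [dist_eq_norm] at h⟩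

/-- *-homomorphisms on the reduced C*-algebra are determined by their values on the `Λ(f)`. -/
theorem hom_ext {B : Type w} [NonUnitalCStarAlgebra B] {φ ψ : 𝒢.ReducedCStar lam →⋆ₙₐ[ℂ] B}
    (h : ∀ (f : C_c(G, ℂ)) (T : 𝒢.ReducedCStar lam), 𝒢.IsRegularRep lam f T.1 → φ T = ψ T)
    (T : 𝒢.ReducedCStar lam) : φ T = ψ T := by
  have hreg : ∀ S ∈ 𝒢.regularAlgebra lam, ∀ hS' : S ∈ 𝒢.reducedAlgebra lam,
      φ (ofMem S hS') = ψ (ofMem S hS') := by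
    intro S hS
    refine NonUnitalStarAlgebra.adjoin_induction ℂ (p := fun S _ =>
      ∀ hS' : S ∈ 𝒢.reducedAlgebra lam, φ (ofMem S hS') = ψ (ofMem S hS')) ?_ ?_ ?_ ?_ ?_ ?_ hS
    · rintro S ⟨f, hf⟩ hS'
      exact h f (ofMem S hS') hf
    · intro S T hS hT h1 h2 h3
      have hS' : S ∈ 𝒢.reducedAlgebra lam := subset_closure hS
      have hT' : T ∈ 𝒢.reducedAlgebra lam := subset_closure hT
      exact (map_add φ (ofMem S hS') (ofMem T hT')).trans
        ((congrArg₂ (· + ·) (h1 hS') (h2 hT')).trans (map_add ψ (ofMem S hS') (ofMem T hT')).symm)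
    · intro h3
      exact (map_zero φ).trans (map_zero ψ).symm
    · intro S T hS hT h1 h2 h3
      have hS' : S ∈ 𝒢.reducedAlgebra lam := subset_closure hS
      have hT' : T ∈ 𝒢.reducedAlgebra lam := subset_closure hT
      exact (_root_.map_mul φ (ofMem S hS') (ofMem T hT')).trans
        ((congrArg₂ (· * ·) (h1 hS') (h2 hT')).trans
          (_root_.map_mul ψ (ofMem S hS') (ofMem T hT')).symm)
    · intro c T hT h1 h3
      have hT' : T ∈ 𝒢.reducedAlgebra lam := subset_closure hT
      exact (map_smul φ c (ofMem T hT')).trans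
        ((congrArg (c • ·) (h1 hT')).trans (map_smul ψ c (ofMem T hT')).symm)
    · intro T hT h1 h3
      have hT' : T ∈ 𝒢.reducedAlgebra lam := subset_closure hT
      exact (map_star φ (ofMem T hT')).trans
        ((congrArg star (h1 hT')).trans (map_star ψ (ofMem T hT')).symm)
  have hcl : IsClosed {T | φ T = ψ T} :=
    isClosed_eq φ.continuous_of_cstar ψ.continuous_of_cstar
  refine hcl.closure_subset (Metric.mem_closure_iff.2 fun ε hε => ?_)
  obtain ⟨S, hS, hST⟩ := T.exists_regular_near hε
  exact ⟨ofMem S (subset_closure hS), hreg S hS _, by rwa [dist_eq_norm]⟩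

end ReducedCStar

end Hom

/-! ### The canonical homomorphisms of the exact sequence -/

section Hom

variable {G : Type u} {X : Type v} [TopologicalSpace G] [TopologicalSpace X]
  [LocallyCompactSpace G] [T2Space G] [MeasurableSpace G] [BorelSpace G]
  {𝒢 : TopologicalGroupoid G X} {lam : X → Measure G} {E : Set X}

namespace IsHaarSystem

variable (hlam : 𝒢.IsHaarSystem lam) (hrs : 𝒢.r = 𝒢.s)

include hlam hrs

/-- The restriction homomorphism `C*_r(𝒢) → C*_r(𝒢(E))` for closed `E`. -/
noncomputable def restrictHom (hE : IsClosed E) :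
    𝒢.ReducedCStar lam →⋆ₙₐ[ℂ] 𝒢.ReducedCStarRestrict lam E where
  toFun T := ReducedCStar.ofMem _ (hlam.restrictFamily_mem hrs hE T.2)
  map_smul' c T := Subtype.ext
    ((hlam.restrictFamily hrs (isClosed_arrows hE).measurableSet).map_smul' c T.1)
  map_zero' := Subtype.ext
    ((hlam.restrictFamily hrs (isClosed_arrows hE).measurableSet).map_zero')
  map_add' S T := Subtype.ext
    ((hlam.restrictFamily hrs (isClosed_arrows hE).measurableSet).map_add' S.1 T.1)
  map_mul' S T := Subtype.ext
    ((hlam.restrictFamily hrs (isClosed_arrows hE).measurableSet).map_mul' S.1 T.1)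
  map_star' T := Subtype.ext
    ((hlam.restrictFamily hrs (isClosed_arrows hE).measurableSet).map_star' T.1)

theorem restrictHom_val (hE : IsClosed E) (T : 𝒢.ReducedCStar lam) :
    (hlam.restrictHom hrs hE T).1 =
      hlam.restrictFamily hrs (isClosed_arrows hE).measurableSet T.1 := rfl

theorem isRestrictionHom_restrictHom (hE : IsClosed E) :
    𝒢.IsRestrictionHom lam E (hlam.restrictHom hrs hE) :=
  fun _ _ hT => hlam.isRegularRep_restrictFamily hrs _ hT

/-- Exactness and the field condition speak of some homomorphism with the right values on the
`Λ(f)`; this identifies it with the concrete one. -/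
theorem eq_restrictHom (hE : IsClosed E)
    {π : 𝒢.ReducedCStar lam →⋆ₙₐ[ℂ] 𝒢.ReducedCStarRestrict lam E}
    (hπ : 𝒢.IsRestrictionHom lam E π) (T : 𝒢.ReducedCStar lam) :
    π T = hlam.restrictHom hrs hE T :=
  ReducedCStar.hom_ext (B := 𝒢.ReducedCStarRestrict lam E) (ψ := hlam.restrictHom hrs hE)
    (fun f T hT => Subtype.ext ((hπ f T hT).unique (hlam.isRestrictionHom_restrictHom hrs hE f T hT))) T

/-- The inclusion `C*_r(𝒢(E)) → C*_r(𝒢)` for open `E`. -/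
noncomputable def extendHom (hE : IsOpen E) :
    𝒢.ReducedCStarRestrict lam E →⋆ₙₐ[ℂ] 𝒢.ReducedCStar lam where
  toFun T := ReducedCStar.ofMem _ (hlam.extendFamily_mem hrs hE T.2)
  map_smul' c T := Subtype.ext
    ((hlam.extendFamily hrs (isOpen_arrows hE).measurableSet).map_smul' c T.1)
  map_zero' := Subtype.ext
    ((hlam.extendFamily hrs (isOpen_arrows hE).measurableSet).map_zero')
  map_add' S T := Subtype.ext
    ((hlam.extendFamily hrs (isOpen_arrows hE).measurableSet).map_add' S.1 T.1)
  map_mul' S T := Subtype.ext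
    ((hlam.extendFamily hrs (isOpen_arrows hE).measurableSet).map_mul' S.1 T.1)
  map_star' T := Subtype.ext
    ((hlam.extendFamily hrs (isOpen_arrows hE).measurableSet).map_star' T.1)

theorem extendHom_val (hE : IsOpen E) (T : 𝒢.ReducedCStarRestrict lam E) :
    (hlam.extendHom hrs hE T).1 =
      hlam.extendFamily hrs (isOpen_arrows hE).measurableSet T.1 := rfl

theorem isInclusionHom_extendHom (hE : IsOpen E) :
    𝒢.IsInclusionHom lam E (hlam.extendHom hrs hE) :=
  fun _ _ hT => hlam.isRegularRep_extendFamily hrs _ hT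

theorem eq_extendHom (hE : IsOpen E)
    {ι : 𝒢.ReducedCStarRestrict lam E →⋆ₙₐ[ℂ] 𝒢.ReducedCStar lam}
    (hι : 𝒢.IsInclusionHom lam E ι) (T : 𝒢.ReducedCStarRestrict lam E) :
    ι T = hlam.extendHom hrs hE T :=
  ReducedCStar.hom_ext (B := 𝒢.ReducedCStar lam) (ψ := hlam.extendHom hrs hE)
    (fun f T hT => Subtype.ext ((hι f T hT).unique (hlam.isInclusionHom_extendHom hrs hE f T hT))) T

theorem extendHom_injective (hE : IsOpen E) : Function.Injective (hlam.extendHom hrs hE) := by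
  intro S T h
  apply Subtype.ext
  have h1 := congrArg (hlam.restrictFamily hrs (isOpen_arrows hE).measurableSet)
    (congrArg Subtype.val h)
  rwa [extendHom_val, extendHom_val, restrictFamily_extendFamily, restrictFamily_extendFamily] at h1

theorem restrictHom_surjective (hE : IsClosed E) :
    Function.Surjective (hlam.restrictHom hrs hE) := by
  refine NonUnitalStarAlgHom.surjective_of_denseRange _ fun T => ?_
  set R := hlam.restrictHom hrs hE with hR
  have key : ∀ S ∈ (𝒢.restrict E).regularAlgebra (𝒢.restrictMeasure lam E),
      ∃ T : 𝒢.ReducedCStar lam, (R T).1 = S := by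
    intro S hS
    refine regularAlgebra_induction (P := fun S => ∃ T : 𝒢.ReducedCStar lam, (R T).1 = S)
      ?_ ?_ ?_ ?_ ?_ hS
    · intro f S hS
      -- By Tietze every generator of `C*_r(𝒢(E))` is the restriction of one of `C*_r(𝒢)`. Hence the
      -- range is dense, and being closed it is everything.
      obtain ⟨g, hg⟩ := exists_compactlySupported_eqOn (isClosed_arrows (𝒢 := 𝒢) hE)
        (f.hasCompactSupport.isCompact.image continuous_subtype_val)
        (f := Function.extend Subtype.val f 0) (by
          rw [continuousOn_iff_continuous_domRestrict]
          exact f.continuous.congr fun γ => (Subtype.val_injective.extend_apply f 0 γ).symm) (by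
          intro γ hγ hγ'
          by_contra h0
          have h1 : Function.extend Subtype.val f 0 γ = f ⟨γ, hγ⟩ :=
            Subtype.val_injective.extend_apply f 0 ⟨γ, hγ⟩
          rw [h1] at h0
          exact hγ' ⟨⟨γ, hγ⟩, subset_tsupport _ h0, rfl⟩)
      obtain ⟨T, hT, -⟩ := hlam.exists_isRegularRep g
      refine ⟨ReducedCStar.ofMem T hT.mem_reducedAlgebra, ?_⟩
      have h2 := hlam.isRestrictionHom_restrictHom hrs hE g
        (ReducedCStar.ofMem T hT.mem_reducedAlgebra) hT
      have h3 : (fun γ : 𝒢.Arrows E => g γ.1) = f := funext fun γ =>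
        (hg γ.1 γ.2).trans (Subtype.val_injective.extend_apply f 0 γ)
      rw [h3] at h2
      exact h2.unique hS
    · rintro _ _ ⟨S, rfl⟩ ⟨T, rfl⟩
      exact ⟨S + T, by rw [map_add]; rfl⟩
    · rintro _ - _ - ⟨S, rfl⟩ ⟨T, rfl⟩
      exact ⟨S * T, by rw [_root_.map_mul]; rfl⟩
    · rintro c _ ⟨T, rfl⟩
      exact ⟨c • T, by rw [map_smul]; rfl⟩
    · rintro _ ⟨T, rfl⟩
      exact ⟨star T, by rw [map_star]; rfl⟩
  refine Metric.mem_closure_iff.2 fun ε hε => ?_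
  obtain ⟨S, hS, hST⟩ := T.exists_regular_near hε
  obtain ⟨S', rfl⟩ := key S hS
  exact ⟨R S', ⟨S', rfl⟩, by rwa [dist_eq_norm]⟩

theorem restrictHom_eq_zero_iff (hE : IsClosed E) (T : 𝒢.ReducedCStar lam) :
    hlam.restrictHom hrs hE T = 0 ↔ ∀ x ∈ E, T.1 x = 0 := by
  constructor
  · intro h x hx
    have h1 := congrArg (fun S : 𝒢.ReducedCStarRestrict lam E => ‖S.1 ⟨x, hx⟩‖) h
    simp only [restrictHom_val, ReducedCStar.zero_val] at h1
    rw [norm_restrictFamily_apply] at h1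
    exact norm_eq_zero.1 (h1.trans norm_zero)
  · intro h
    refine Subtype.ext (lp.ext (funext fun x => ?_))
    rw [restrictHom_val, restrictFamily_apply, h x x.2]
    exact map_zero _

theorem norm_restrictHom_singleton [T1Space X] (x : X) (T : 𝒢.ReducedCStar lam) :
    ‖hlam.restrictHom hrs (isClosed_singleton (x := x)) T‖ = ‖T.1 x‖ := by
  rw [ReducedCStar.norm_def, restrictHom_val]
  refine le_antisymm (lp.norm_le_of_forall_le (norm_nonneg _) fun y => ?_) ?_
  · rw [norm_restrictFamily_apply, y.2]
  · rw [← hlam.norm_restrictFamily_apply hrs (isClosed_arrows isClosed_singleton).measurableSet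
      T.1 (⟨x, rfl⟩ : ({x} : Set X))]
    exact lp.norm_apply_le_norm (by simp) _ _

end IsHaarSystem

end Hom

end TopologicalGroupoid

namespace TopologicalGroupoid

/-! ### Exactness versus continuity of the norm functions -/

section Main

variable {G : Type u} {X : Type v} [TopologicalSpace G] [TopologicalSpace X]
  [LocallyCompactSpace G] [T2Space G] [MeasurableSpace G] [BorelSpace G]
  {𝒢 : TopologicalGroupoid G X} {lam : X → Measure G}

namespace IsHaarSystem

variable (hlam : 𝒢.IsHaarSystem lam) (hrs : 𝒢.r = 𝒢.s)

include hlam hrs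

/-- Exactness at the point `x` gives upper semicontinuity of the norm functions at `x`. -/
theorem eventually_norm_lt {x : X} (h : 𝒢.IsExactSequence lam {x}) (T : 𝒢.ReducedCStar lam) {c : ℝ}
    (hc : ‖T.1 x‖ < c) : ∀ᶠ y in 𝓝 x, ‖T.1 y‖ < c := by
  have := 𝒢.t2Space_units
  have hcl : IsClosed ({x} : Set X) := isClosed_singleton
  obtain ⟨ι, π, hι, hπ, -, hex, -⟩ := h
  have hc0 : 0 ≤ c := (norm_nonneg _).trans hc.le
  -- Passing to the self-adjoint element `T* T` allows a lift without loss of norm: `‖a‖ ≤ ‖T_x‖²`.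
  -- By exactness the difference `T* T - a` comes from the open complement of `x`.
  obtain ⟨a, ha, hale⟩ := π.exists_lift_of_isSelfAdjoint (IsSelfAdjoint.star_mul_self T)
  have hnorm : ‖π (star T * T)‖ = ‖T.1 x‖ ^ 2 := by
    rw [hlam.eq_restrictHom hrs hcl hπ, hlam.norm_restrictHom_singleton hrs, ReducedCStar.mul_val,
      ReducedCStar.star_val, mul_apply, lp.star_apply, CStarRing.norm_star_mul_self, sq]
  have hker : π (star T * T - a) = 0 := by rw [map_sub, ha, sub_self]
  obtain ⟨s, hs⟩ := (hex _).1 hker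
  have hδ : 0 < c ^ 2 - ‖T.1 x‖ ^ 2 := by
    have := pow_lt_pow_left₀ hc (norm_nonneg _) two_ne_zero
    linarith
  -- `s'` extends by zero to a family vanishing off a compact `K` missing `x`. Off `K` only `a` and
  -- the error `s - s'` contribute, with total norm below `‖T_x‖² + (c² - ‖T_x‖²) = c²`.
  obtain ⟨s', hs', hss'⟩ := s.exists_regular_near hδ
  obtain ⟨K, hK, hKx, hK0⟩ := hlam.exists_compact_support_extendFamily hrs hcl.isOpen_compl hs'
  have hxK : x ∉ K := fun hx => hKx hx rfl
  filter_upwards [hK.isClosed.isOpen_compl.mem_nhds hxK] with y hy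
  set e := hlam.extendFamily hrs (isOpen_arrows hcl.isOpen_compl).measurableSet with he
  have h1 : (star T * T).1 = a.1 + e s.1 := by
    have h2 : (ι s).1 = e s.1 := by rw [hlam.eq_extendHom hrs hcl.isOpen_compl hι]; rfl
    rw [← h2, hs, ReducedCStar.sub_val, add_sub_cancel]
  have h3 : (star T * T).1 y = a.1 y + e (s.1 - s') y := by
    rw [h1, lp.coeFn_add, Pi.add_apply]
    congr 1
    have h4 : e (s.1 - s') y = e s.1 y - e s' y :=
      congrArg (fun S : FibreOperators lam => S y) (map_sub e s.1 s')
    rw [h4, hK0 y hy, sub_zero]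
  have h5 : ‖T.1 y‖ ^ 2 < c ^ 2 := by
    have h6 : ‖(star T * T).1 y‖ = ‖T.1 y‖ ^ 2 := by
      rw [ReducedCStar.mul_val, ReducedCStar.star_val, mul_apply, lp.star_apply,
        CStarRing.norm_star_mul_self, sq]
    rw [← h6, h3]
    refine (norm_add_le _ _).trans_lt ?_
    have h7 : ‖a.1 y‖ ≤ ‖a‖ := lp.norm_apply_le_norm (by simp) a.1 y
    have h8 : ‖e (s.1 - s') y‖ ≤ ‖e (s.1 - s')‖ := lp.norm_apply_le_norm (by simp) _ y
    rw [he, hlam.norm_extendFamily] at h8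
    rw [hnorm] at hale
    rw [← he] at h8
    linarith
  exact lt_of_pow_lt_pow_left₀ 2 hc0 h5

theorem isCStarField [T1Space X] :
    IsCStarField fun x : X => hlam.restrictHom hrs (isClosed_singleton (x := x)) := by
  have := 𝒢.t2Space_units
  have := 𝒢.locallyCompactSpace_units
  have hsmul : ∀ (f : C₀(X, ℂ)) (a : 𝒢.ReducedCStar lam) (x : X),
      hlam.restrictHom hrs (isClosed_singleton (x := x))
        (ReducedCStar.ofMem (diag lam f * a.1) (hlam.diag_mul_mem hrs f a.2)) =
      f x • hlam.restrictHom hrs (isClosed_singleton (x := x)) a := by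
    intro f a x
    refine Subtype.ext (lp.ext (funext fun y => ?_))
    obtain ⟨y, rfl⟩ := y
    rw [ReducedCStar.smul_val, restrictHom_val, restrictHom_val, restrictFamily_apply,
      ReducedCStar.ofMem_val, diag_mul_apply, map_smul]
    rfl
  refine ⟨fun x => hlam.restrictHom_surjective hrs _, fun a => ?_, fun f a => ⟨_, hsmul f a⟩, ?_⟩
  · simp only [norm_restrictHom_singleton]
    exact lp.norm_eq_ciSup a.1
  · intro a
    refine Metric.mem_closure_iff.2 fun ε hε => ?_
    obtain ⟨S, hS, haS⟩ := a.exists_regular_near hε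
    obtain ⟨K, hK, hSK⟩ := hlam.exists_compact_support hrs hS
    -- A function equal to `1` on the compact support of `S` fixes `S`, so these dense elements are
    -- already of the form `fa`.
    obtain ⟨g, L, -, -, hg1, -, -⟩ := exists_zeroAtInfty_bump hK isOpen_univ (Set.subset_univ K)
    have hgS : diag lam g * S = S := by
      refine lp.ext (funext fun x => ?_)
      rw [diag_mul_apply]
      by_cases hx : x ∈ K
      · rw [hg1 x hx, one_smul]
      · rw [hSK x hx, smul_zero]
    have hS' : S ∈ 𝒢.reducedAlgebra lam := subset_closure hS
    refine ⟨ReducedCStar.ofMem S hS', Submodule.subset_span ⟨g, ReducedCStar.ofMem S hS',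
      fun x => ?_⟩, by rwa [dist_eq_norm]⟩
    rw [← hsmul]
    exact congrArg _ (Subtype.ext hgS.symm)

theorem isContinuousCStarField [T1Space X] (h : ∀ x : X, 𝒢.IsExactSequence lam {x}) :
    IsContinuousCStarField fun x : X => hlam.restrictHom hrs (isClosed_singleton (x := x)) := by
  have := 𝒢.t2Space_units
  refine ⟨hlam.isCStarField hrs, fun a => ?_⟩
  have hcont : Continuous fun x => ‖a.1 x‖ := by
    rw [continuous_iff_lower_upperSemicontinuous]
    exact ⟨hlam.lowerSemicontinuous_norm a.2,
      fun x c hc => hlam.eventually_norm_lt hrs (h x) a hc⟩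
  refine ⟨⟨⟨fun x => ‖a.1 x‖, hcont⟩, ?_⟩, fun x => (hlam.norm_restrictHom_singleton hrs x a).symm⟩
  rw [Metric.tendsto_nhds]
  intro ε hε
  obtain ⟨K, hK, hKε⟩ := hlam.exists_compact_norm_lt hrs a.2 hε
  filter_upwards [hK.compl_mem_cocompact] with x hx
  rw [dist_zero_right, norm_norm]
  exact hKε x hx

/-- If the norm functions are in `C₀(X)`, then the sequence of every closed set is exact. -/
theorem isExactSequence (h : ∀ a : 𝒢.ReducedCStar lam, ∃ g : C₀(X, ℝ), ∀ x, g x = ‖a.1 x‖)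
    {F : Set X} (hF : IsClosed F) : 𝒢.IsExactSequence lam F := by
  have := 𝒢.t2Space_units
  have := 𝒢.locallyCompactSpace_units
  refine ⟨hlam.extendHom hrs hF.isOpen_compl, hlam.restrictHom hrs hF,
    hlam.isInclusionHom_extendHom hrs _, hlam.isRestrictionHom_restrictHom hrs hF,
    hlam.extendHom_injective hrs _, fun a => ?_, hlam.restrictHom_surjective hrs hF⟩
  rw [restrictHom_eq_zero_iff]
  constructor
  · intro ha
    have haU : ∀ x ∉ Fᶜ, a.1 x = 0 := fun x hx => ha x (not_not.1 hx)
    have hmem : hlam.restrictFamily hrs (isOpen_arrows hF.isOpen_compl).measurableSet a.1 ∈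
        (𝒢.restrict Fᶜ).reducedAlgebra (𝒢.restrictMeasure lam Fᶜ) := by
      refine isClosed_reducedAlgebra.closure_subset (Metric.mem_closure_iff.2 fun ε hε => ?_)
      obtain ⟨g, hg⟩ := h a
      obtain ⟨K, hK, hKε⟩ : ∃ K : Set X, IsCompact K ∧ ∀ x ∉ K, ‖a.1 x‖ < ε / 2 := by
        have h1 := (Metric.tendsto_nhds.1 g.zero_at_infty') (ε / 2) (half_pos hε)
        obtain ⟨K, hK, hKsub⟩ := Filter.mem_cocompact.1 h1
        refine ⟨K, hK, fun x hx => ?_⟩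
        have h2 : dist (g x) 0 < ε / 2 := hKsub hx
        rwa [hg x, dist_zero_right, norm_norm] at h2
      -- Continuity of the norm function makes this set closed, and vanishing at infinity places it
      -- in a compact set. Upper semicontinuity enters exactly here.
      have hK' : IsCompact (K ∩ {x | ε / 2 ≤ ‖a.1 x‖}) := by
        refine hK.inter_right ?_
        simp only [← hg]
        exact isClosed_le continuous_const g.continuous
      have hK'F : K ∩ {x | ε / 2 ≤ ‖a.1 x‖} ⊆ Fᶜ := by
        rintro x ⟨-, hx⟩ hxF
        have h3 : ε / 2 ≤ ‖a.1 x‖ := hx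
        rw [ha x hxF, norm_zero] at h3
        linarith
      obtain ⟨f, L, hL, hLF, hf1, hf0, hf⟩ :=
        exists_zeroAtInfty_bump hK' hF.isOpen_compl hK'F
      refine ⟨_, hlam.restrictFamily_diag_mul_mem hrs hF.isOpen_compl a.2 hL hLF hf0, ?_⟩
      rw [dist_eq_norm]
      refine lt_of_le_of_lt (lp.norm_le_of_forall_le (half_pos hε).le fun x => ?_) (half_lt_self hε)
      have h4 : ‖a.1 - diag lam f * a.1‖ ≤ ε / 2 := by
        refine norm_diag_mul_sub_le (half_pos hε).le hf fun x hx => hf1 x ⟨?_, hx.le⟩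
        by_contra hxK
        exact absurd (hKε x hxK) (not_lt.2 hx.le)
      have h5 := map_sub (hlam.restrictFamily hrs
        (isOpen_arrows (𝒢 := 𝒢) hF.isOpen_compl).measurableSet) a.1 (diag lam f * a.1)
      rw [← h5, norm_restrictFamily_apply]
      exact (lp.norm_apply_le_norm (by simp) (a.1 - diag lam f * a.1) x).trans h4
    refine ⟨ReducedCStar.ofMem _ hmem, Subtype.ext ?_⟩
    rw [extendHom_val, ReducedCStar.ofMem_val]
    exact hlam.extendFamily_restrictFamily hrs _ haU
  · rintro ⟨s, rfl⟩ x hx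
    rw [extendHom_val]
    exact hlam.extendFamily_of_notMem hrs _ s.1 fun h => h hx

end IsHaarSystem

end Main

end TopologicalGroupoid

theorem mainTheorem6 {G : Type u} {X : Type v} [TopologicalSpace G] [TopologicalSpace X]
    [LocallyCompactSpace G] [T2Space G] [MeasurableSpace G] [BorelSpace G]
    (𝒢 : TopologicalGroupoid G X) (h𝒢 : 𝒢.IsGroupBundle)
    (lam : X → Measure G) (hlam : 𝒢.IsHaarSystem lam) :
    List.TFAE
      [𝒢.IsInnerExact lam,
        ∀ x : X, 𝒢.IsExactSequence lam {x},
        ∃ π : ∀ x : X, 𝒢.ReducedCStar lam →⋆ₙₐ[ℂ] 𝒢.ReducedCStarRestrict lam {x},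
          (∀ x, 𝒢.IsRestrictionHom lam {x} (π x)) ∧ IsContinuousCStarField π] := by
  have hrs := h𝒢.1
  have := 𝒢.t2Space_units
  -- Since `r = s`, every set of units is invariant, singletons included.
  tfae_have 1 → 2 := fun h x => h {x} isClosed_singleton fun γ => by rw [hrs]
  tfae_have 2 → 3 := fun h => ⟨fun x => hlam.restrictHom hrs isClosed_singleton,
    fun x => hlam.isRestrictionHom_restrictHom hrs isClosed_singleton,
    hlam.isContinuousCStarField hrs h⟩
  tfae_have 3 → 1 := by
    rintro ⟨π, hπ, hfield⟩ F hF -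
    refine hlam.isExactSequence hrs (fun a => ?_) hF
    obtain ⟨g, hg⟩ := hfield.norm_mem a
    refine ⟨g, fun x => ?_⟩
    rw [hg x, hlam.eq_restrictHom hrs isClosed_singleton (hπ x), hlam.norm_restrictHom_singleton]
  tfae_finish
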